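/- Consider the following network model. The typical UAV hovers at height $h>0$ above the origin of the plane, and the projections of the other UAVs form a homogeneous Poisson point process $\Phi$ on $\mathbb R^2$ with intensity $\lambda>0$. Every UAV $u\in\Phi$ carries a cluster of $N$ devices on the ground, independent and uniformly distributed in the disc of radius $R>0$ around $u$ (Matérn cluster process). On each of $M\le N$ resource blocks exactly one device per cluster transmits; the devices are assigned to the resource blocks uniformly at random without replacement. Fix a resource block. Independently for each $u\in\Phi$ with $q=\|u\|$, the link from the cluster of $u$ to the typical UAV is LOS ($z=L$) with probability $$P_L(q)=\frac1{1+a\exp\left(-b\left[\frac{180}{\pi}\arctan(h/q)-a\right]\right)}\qquad (a>0,\ b\in\mathbb R)$$ and NLOS ($z=N$) with probability $P_N(q)=1-P_L(q)$. If this link has state $z$ and the transmitting device of the cluster is at horizontal distance $g$ from the origin, then the cluster contributes the power $P_d\,G\,|\mathsf h|_z^2\,(g^2+h^2)^{-\alpha_z/2}$, where $P_d>0$, $\alpha_z>2$, the fading power $|\mathsf h|_z^2$ is gamma distributed with shape $m_z>0$ and rate $m_z$ (normalized Nakagami-$m_z$ fading), and the antenna gain $G$ takes the value $G_i$ with probability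 $p_i$, $i=1,\dots,4$, where $(G_1,\dots,G_4)=(M_uM_d,\ M_um_d,\ m_uM_d,\ m_um_d)$ with lobe gains $M_u,m_u,M_d,m_d\ge 0$, and, for beamwidths $\theta_u,\theta_d\in[0,2\pi]$, $t_u=\theta_u/2\pi$, $t_d=\theta_d/2\pi$, $(p_1,\dots,p_4)=(t_ut_d,\ t_u(1-t_d),\ (1-t_u)t_d,\ (1-t_u)(1-t_d))$. The Poisson process, link states (given the UAV positions), schedules, displacements of the devices from their UAVs, fading powers and gains are independent. Let $I_{\mathrm{UL}}$, the inter-cluster uplink interference, be the sum of the contributions of all $u\in\Phi$. Then $I_{\mathrm{UL}}<\infty$ almost surely, and for all $s\ge 0$ its Laplace transform $\mathcal L_{\mathrm{UL}}(s)=\mathbb E[e^{-sI_{\mathrm{UL}}}]$ is $$\mathcal L_{\mathrm{UL}}(s)=\prod_{z\in\{L,N\}}\exp\left(-2\pi\lambda\left[\int_0^R\left(1-O_{e1}^z(s,q)\right)q\,P_z(q)\,dq+\int_R^\infty\left(1-O_{e2}^z(s,q)\right)q\,P_z(q)\,dq\right]\right),$$ where the integrals converge absolutely and, with $\kappa_z(s,g)=\sum_{i=1}^4p_i\left(1+\frac{sP_dG_i(g^2+h^2)^{-\alpha_z/2}}{m_z}\right)^{-m_z}$,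 $$O_{e1}^z(s,q)=\int_{|q-R|}^{R+q}\kappa_z(s,g)\,\frac{2g}{\pi R^2}\arccos\left(\frac{g^2+q^2-R^2}{2gq}\right)dg+\int_0^{R-q}\kappa_z(s,g)\,\frac{2g}{R^2}\,dg,$$ $$O_{e2}^z(s,q)=\int_{|q-R|}^{R+q}\kappa_z(s,g)\,\frac{2g}{\pi R^2}\arccos\left(\frac{g^2+q^2-R^2}{2gq}\right)dg.$$ -/

import Mathlib

open MeasureTheory ProbabilityTheory
open scoped ENNReal

namespace UavNetwork

noncomputable section

/-- The ground plane with its Euclidean norm. -/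
abbrev Plane : Type := EuclideanSpace ℝ (Fin 2)

/-- The state of an air-to-ground link: line of sight or non line of sight. -/
inductive LinkType : Type
  | los
  | nlos
  deriving DecidableEq

instance : Fintype LinkType := ⟨{.los, .nlos}, fun z => by cases z <;> simp⟩

/-- The numerical parameters of the network. -/
structure Params where
  /-- intensity of the UAV process -/
  lam : ℝ
  /-- cluster radius -/
  R : ℝ
  /-- height of the UAVs -/
  h : ℝ
  /-- environment constants of the line-of-sight probability -/
  a : ℝ
  b : ℝ
  /-- transmission power of a device -/
  Pd : ℝ
  /-- main and side lobe gains of the UAV antenna -/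
  mainU : ℝ
  sideU : ℝ
  /-- main and side lobe gains of the device antenna -/
  mainD : ℝ
  sideD : ℝ
  /-- main lobe beamwidths of the UAV and the device antennas -/
  thetaU : ℝ
  thetaD : ℝ
  /-- path loss exponents -/
  α : LinkType → ℝ
  /-- Nakagami fading parameters -/
  m : LinkType → ℝ
  /-- number of devices of a cluster -/
  N : ℕ
  /-- number of resource blocks of a UAV -/
  M : ℕ

/-- The admissible ranges of the parameters. -/
structure Params.Admissible (p : Params) : Prop where
  lam_pos : 0 < p.lam
  R_pos : 0 < p.R
  h_pos : 0 < p.h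
  a_pos : 0 < p.a
  Pd_pos : 0 < p.Pd
  mainU_nonneg : 0 ≤ p.mainU
  sideU_nonneg : 0 ≤ p.sideU
  mainD_nonneg : 0 ≤ p.mainD
  sideD_nonneg : 0 ≤ p.sideD
  thetaU_mem : p.thetaU ∈ Set.Icc 0 (2 * Real.pi)
  thetaD_mem : p.thetaD ∈ Set.Icc 0 (2 * Real.pi)
  two_lt_α : ∀ z, 2 < p.α z
  m_pos : ∀ z, 0 < p.m z
  M_le_N : p.M ≤ p.N

namespace Params

variable (p : Params)

/-- Probability of a line-of-sight link at horizontal distance `r` (used for `r > 0`). -/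
def losProb (r : ℝ) : ℝ :=
  1 / (1 + p.a * Real.exp (-p.b * (180 / Real.pi * Real.arctan (p.h / r) - p.a)))

/-- `P_z(r)`: the probability that a link at horizontal distance `r` is of type `z`. -/
def linkProb : LinkType → ℝ → ℝ
  | .los, r => p.losProb r
  | .nlos, r => 1 - p.losProb r

/-- The four values `G_i` of the directionality gain of an interfering link. -/
def gain : Fin 4 → ℝ :=
  ![p.mainU * p.mainD, p.mainU * p.sideD, p.sideU * p.mainD, p.sideU * p.sideD]

/-- The probabilities `p_i` of the four antenna patterns. -/
def gainProb : Fin 4 → ℝ :=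
  ![p.thetaU / (2 * Real.pi) * (p.thetaD / (2 * Real.pi)),
    p.thetaU / (2 * Real.pi) * (1 - p.thetaD / (2 * Real.pi)),
    (1 - p.thetaU / (2 * Real.pi)) * (p.thetaD / (2 * Real.pi)),
    (1 - p.thetaU / (2 * Real.pi)) * (1 - p.thetaD / (2 * Real.pi))]

/-- The law of the directionality gain of an interfering link. -/
def gainLaw : Measure ℝ :=
  ∑ i : Fin 4, ENNReal.ofReal (p.gainProb i) • Measure.dirac (p.gain i)

/-- Normalized path loss `(g² + h²)^(-α_z / 2)` over a link of horizontal length `g`. -/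
def pathLoss (z : LinkType) (g : ℝ) : ℝ := (g ^ 2 + p.h ^ 2) ^ (-(p.α z) / 2)

end Params

/-- What is attached to a device: its displacement from the projection of its own UAV, the
directionality gain of its link to the typical UAV, and the power of the small-scale fading of that
link in either link state. -/
abbrev DeviceMark : Type := Plane × ℝ × (LinkType → ℝ)

/-- The law of a device: uniform in the disc of radius `R`, random antenna pattern, and normalized
(unit mean) Nakagami-`m_z` fading, whose power is gamma distributed with shape and rate `m_z`; all
independent. -/
def Params.deviceLaw (p : Params) : Measure DeviceMark :=
  (cond (volume : Measure Plane) (Metric.closedBall 0 p.R)).prod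
    (p.gainLaw.prod (Measure.pi fun z => gammaMeasure (p.m z) (p.m z)))

/-- What is attached to a cluster: a number in `[0, 1]` that decides the link state, the
schedule (the device that uses each resource block), and the devices. -/
abbrev Params.ClusterMark (p : Params) : Type :=
  ℝ × (Fin p.M → Fin p.N) × (Fin p.N → DeviceMark)

/-- The law of a cluster: a uniform number, a uniformly random assignment without replacement of
devices to the resource blocks, and `N` independent devices; all independent. -/
def Params.clusterLaw (p : Params) : Measure p.ClusterMark :=
  ((volume : Measure ℝ).restrict (Set.Icc 0 1)).prod
    ((uniformOn {f : Fin p.M → Fin p.N | Function.Injective f}).prod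
      (Measure.pi fun _ => p.deviceLaw))

variable {Ω : Type*} [MeasurableSpace Ω]

/-- The number of points of `X` in `B`. -/
def pointCount {E : Type*} (X : ℕ → Ω → E) (B : Set E) (ω : Ω) : ℝ≥0∞ :=
  ∑' n, B.indicator (fun _ => 1) (X n ω)

/-- `X` enumerates a Poisson point process with intensity measure `Λ`: the number of points in a
set of finite measure is Poisson, and the numbers of points in disjoint sets are independent. -/
structure IsPoissonProcess {E : Type*} [MeasurableSpace E] (P : Measure Ω) (Λ : Measure E)
    (X : ℕ → Ω → E) : Prop where
  measurable : ∀ n, Measurable (X n)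
  poisson : ∀ B : Set E, MeasurableSet B → Λ B ≠ ∞ →
    HasLaw (pointCount X B) ((poissonMeasure (Λ B).toNNReal).map (fun k : ℕ => (k : ℝ≥0∞))) P
  indep : ∀ (k : ℕ) (B : Fin k → Set E), (∀ i, MeasurableSet (B i)) →
    Pairwise (fun i j => Disjoint (B i) (B j)) → iIndepFun (fun i => pointCount X (B i)) P

/-- The points `X` carry independent marks `T` with common law `ν`, independent of `X`. -/
structure IsIndependentMarking {E F : Type*} [MeasurableSpace E] [MeasurableSpace F]
    (P : Measure Ω) (ν : Measure F) (X : ℕ → Ω → E) (T : ℕ → Ω → F) : Prop where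
  measurable : ∀ n, Measurable (T n)
  law : ∀ n, HasLaw (T n) ν P
  indep : iIndepFun T P
  indep_points : IndepFun (fun ω n => X n ω) (fun ω n => T n ω) P

/-- The network seen from the typical UAV, whose projection is the origin. The other UAVs `X` form
a homogeneous Poisson process of intensity `λ`, and each of them carries an independent cluster. -/
structure IsNetwork (p : Params) (P : Measure Ω) (X : ℕ → Ω → Plane)
    (T : ℕ → Ω → p.ClusterMark) : Prop where
  parents : IsPoissonProcess P (ENNReal.ofReal p.lam • (volume : Measure Plane)) X
  clusters : IsIndependentMarking P p.clusterLaw X T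

/-- The link state of the `n`-th interfering cluster: line of sight with probability
`P_L(q)`, where `q` is the distance of its UAV. -/
def linkType (p : Params) (X : ℕ → Ω → Plane) (T : ℕ → Ω → p.ClusterMark) (n : ℕ) (ω : Ω) :
    LinkType :=
  if (T n ω).1 ≤ p.losProb ‖X n ω‖ then .los else .nlos

/-- The device of the `n`-th interfering cluster that transmits on resource block `c`. -/
def activeDevice (p : Params) (T : ℕ → Ω → p.ClusterMark) (c : Fin p.M) (n : ℕ) (ω : Ω) :
    DeviceMark :=
  (T n ω).2.2 ((T n ω).2.1 c)

/-- The power `P_d G |h|_z² (g² + h²)^(-α_z / 2)` received at the typical UAV on resource block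
`c` from the `n`-th interfering cluster if its link state is `z`, where `g` is the distance of the
transmitting device; zero if its link state is not `z`. -/
def receivedPower (p : Params) (X : ℕ → Ω → Plane) (T : ℕ → Ω → p.ClusterMark) (c : Fin p.M)
    (z : LinkType) (n : ℕ) (ω : Ω) : ℝ :=
  if linkType p X T n ω = z then
    p.Pd * (activeDevice p T c n ω).2.1 * (activeDevice p T c n ω).2.2 z *
      p.pathLoss z ‖X n ω + (activeDevice p T c n ω).1‖
  else 0

/-- The inter-cluster uplink interference `I_UL = I_UL^L + I_UL^N` on resource block `c`. -/
def interference (p : Params) (X : ℕ → Ω → Plane) (T : ℕ → Ω → p.ClusterMark) (c : Fin p.M)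
    (ω : Ω) : ℝ :=
  ∑ z : LinkType, ∑' n, receivedPower p X T c z n ω

/-- The Laplace transform `s ↦ E[exp (-s I)]` of a random variable. -/
def laplaceTransform (P : Measure Ω) (I : Ω → ℝ) (s : ℝ) : ℝ := ∫ ω, Real.exp (-s * I ω) ∂P

namespace Params

variable (p : Params)

/-- `∑ p_i (1 + s P_d G_i (g² + h²)^(-α_z / 2) / m_z)^(-m_z)`. -/
def linkFactor (z : LinkType) (s g : ℝ) : ℝ :=
  ∑ i : Fin 4, p.gainProb i * (1 + s * p.Pd * p.gain i * p.pathLoss z g / p.m z) ^ (-(p.m z))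

/-- `O_{e2}^z(s, q)`. -/
def Oe2 (z : LinkType) (s q : ℝ) : ℝ :=
  ∫ g in |q - p.R|..(p.R + q), p.linkFactor z s g *
    (2 * g / (Real.pi * p.R ^ 2) * Real.arccos ((g ^ 2 + q ^ 2 - p.R ^ 2) / (2 * g * q)))

/-- `O_{e1}^z(s, q)`. -/
def Oe1 (z : LinkType) (s q : ℝ) : ℝ :=
  (∫ g in |q - p.R|..(p.R + q), p.linkFactor z s g *
    (2 * g / (Real.pi * p.R ^ 2) * Real.arccos ((g ^ 2 + q ^ 2 - p.R ^ 2) / (2 * g * q)))) +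
  ∫ g in (0 : ℝ)..(p.R - q), p.linkFactor z s g * (2 * g / p.R ^ 2)

end Params

end

end UavNetwork

/-! ### Poisson processes: Campbell's formula, and the generating functional on simple functions. -/

namespace UavNetwork

open Filter Topology
open scoped NNReal

/-! The interference is a sum of nonnegative terms over an independently marked Poisson process, so
its Laplace transform is the Laplace functional: the exponential of minus the integral, over the
plane with intensity λ, of one minus the Laplace transform of the power from a single cluster
(`integral_exp_neg_tsum_marked`). For a sequence of points known only through its counts, this
functional comes from the limit of `∏ (1 - u (X n))` over the first `k` points. For simple `u` the
product groups into powers of independent Poisson counts; general `u` is approximated from below in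
L¹, with an error that Campbell's formula bounds uniformly in `k`. Marks are integrated out first,
by independence and Fubini.

The mean interference is finite: averaging over UAV positions first, translation invariance reduces
it to the integral of the path loss over the plane, finite because `α_z > 2` and `h > 0`. This gives
almost sure summability and, as `1 - exp (-y) ≤ y`, absolute convergence of the integrals.

For one cluster at `x ≠ 0` the active device has the law of any device, whatever the schedule.
Averaging over the gain and the gamma fading gives `linkFactor`. Averaging that over the disc in
polar coordinates about the origin gives `avgFactor`: the circle of radius `g` meets the disc in an
arc whose half-angle is an arccosine, by the law of cosines. The regimes where the circle misses the
disc or lies inside it yield `Oe2` and `Oe1`. Since the link probabilities sum to one, the exponent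
splits over the link states, and polar coordinates in the UAV position finish the computation. -/

theorem lintegral_natCast_poissonMeasure (r : ℝ≥0) :
    ∫⁻ n : ℕ, (n : ℝ≥0∞) ∂poissonMeasure r = r := by
  have h : HasSum (fun n : ℕ => Real.exp (-r) * (r : ℝ) ^ n / n.factorial * n) r := by
    rw [← hasSum_nat_add_iff' 1]
    convert! (hasSum_one_poissonMeasure r).mul_left (r : ℝ) using 1
    · ext n
      rw [Nat.factorial_succ]
      push_cast
      field_simp
      ring
    · simp
  rw [poissonMeasure, lintegral_sum_measure]
  simp only [lintegral_smul_measure, lintegral_dirac, smul_eq_mul]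
  have h0 : ∀ n : ℕ, 0 ≤ Real.exp (-r) * (r : ℝ) ^ n / n.factorial := fun n => by positivity
  calc ∑' n : ℕ, ENNReal.ofReal (Real.exp (-r) * (r : ℝ) ^ n / n.factorial) * (n : ℝ≥0∞)
      = ∑' n : ℕ, ENNReal.ofReal (Real.exp (-r) * (r : ℝ) ^ n / n.factorial * n) := by
        congr with n
        rw [ENNReal.ofReal_mul (h0 n), ENNReal.ofReal_natCast]
    _ = ENNReal.ofReal r := by
        rw [← ENNReal.ofReal_tsum_of_nonneg (fun n => mul_nonneg (h0 n) n.cast_nonneg)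
          h.summable, h.tsum_eq]
    _ = r := ENNReal.ofReal_coe_nnreal

theorem integral_pow_poissonMeasure (r : ℝ≥0) (c : ℝ) :
    ∫ n : ℕ, c ^ n ∂poissonMeasure r = Real.exp (-((1 - c) * r)) := by
  rw [integral_poissonMeasure]
  have h := (NormedSpace.expSeries_div_hasSum_exp ((r : ℝ) * c)).mul_left (Real.exp (-r))
  rw [← Real.exp_eq_exp_ℝ, ← Real.exp_add] at h
  rw [show -((1 - c) * r) = -(r : ℝ) + r * c by ring, ← h.tsum_eq]
  congr with n
  rw [smul_eq_mul, mul_pow]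
  ring

/-- Replacing the factors one at a time costs at most the change in each, the others being at most
1. This turns products over points into sums, which Campbell's formula integrates. -/
theorem abs_prod_sub_prod_le {ι : Type*} (t : Finset ι) {f g : ι → ℝ}
    (hf : ∀ i, f i ∈ Set.Icc 0 1) (hg : ∀ i, g i ∈ Set.Icc 0 1) :
    |∏ i ∈ t, f i - ∏ i ∈ t, g i| ≤ ∑ i ∈ t, |f i - g i| := by
  classical
  induction t using Finset.induction_on with
  | empty => simp
  | insert a t ha ih =>
    rw [Finset.prod_insert ha, Finset.prod_insert ha, Finset.sum_insert ha]
    have h1 : ∏ i ∈ t, g i ∈ Set.Icc (0 : ℝ) 1 :=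
      ⟨Finset.prod_nonneg fun i _ => (hg i).1, Finset.prod_le_one (fun i _ => (hg i).1)
        fun i _ => (hg i).2⟩
    calc |f a * ∏ i ∈ t, f i - g a * ∏ i ∈ t, g i|
        = |f a * (∏ i ∈ t, f i - ∏ i ∈ t, g i) + (f a - g a) * ∏ i ∈ t, g i| := by
          congr 1; ring
      _ ≤ |f a| * |∏ i ∈ t, f i - ∏ i ∈ t, g i| + |f a - g a| * |∏ i ∈ t, g i| := by
          rw [← abs_mul, ← abs_mul]; exact abs_add_le _ _
      _ ≤ 1 * |∏ i ∈ t, f i - ∏ i ∈ t, g i| + |f a - g a| * 1 := by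
          gcongr
          · rw [abs_of_nonneg (hf a).1]; exact (hf a).2
          · rw [abs_of_nonneg h1.1]; exact h1.2
      _ ≤ |f a - g a| + ∑ i ∈ t, |f i - g i| := by linarith

variable {Ω E : Type*} [MeasurableSpace Ω] [MeasurableSpace E] {P : Measure Ω} {Λ : Measure E}
  {X : ℕ → Ω → E}

namespace IsPoissonProcess

theorem measurable_pointCount (h : IsPoissonProcess P Λ X) {B : Set E} (hB : MeasurableSet B) :
    Measurable (pointCount X B) :=
  Measurable.tsum fun n => (measurable_const.indicator hB).comp (h.measurable n)

theorem lintegral_pointCount (h : IsPoissonProcess P Λ X) {B : Set E} (hB : MeasurableSet B)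
    (hΛ : Λ B ≠ ∞) : ∫⁻ ω, pointCount X B ω ∂P = Λ B := by
  have h1 := (h.poisson B hB hΛ).lintegral_comp (f := fun x => x) aemeasurable_id'
  rw [h1, lintegral_map measurable_id' (measurable_from_nat), lintegral_natCast_poissonMeasure,
    ENNReal.coe_toNNReal hΛ]

/-- Campbell's theorem: the mean measure of a Poisson process is its intensity. -/
theorem sum_map_eq [SigmaFinite Λ] (h : IsPoissonProcess P Λ X) :
    Measure.sum (fun n => P.map (X n)) = Λ := by
  have key : ∀ B : Set E, MeasurableSet B → Λ B ≠ ∞ →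
      Measure.sum (fun n => P.map (X n)) B = Λ B := by
    intro B hB hΛ
    rw [← h.lintegral_pointCount hB hΛ, Measure.sum_apply _ hB]
    unfold pointCount
    have hm : ∀ n, Measurable fun ω => B.indicator (fun _ => (1 : ℝ≥0∞)) (X n ω) := fun n =>
      (measurable_const.indicator hB).comp (h.measurable n)
    rw [lintegral_tsum fun n => (hm n).aemeasurable]
    congr with n
    rw [Measure.map_apply (h.measurable n) hB]
    have : (fun ω => B.indicator (fun _ => (1 : ℝ≥0∞)) (X n ω)) =
        (X n ⁻¹' B).indicator fun _ => 1 := rfl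
    rw [this, lintegral_indicator_const (h.measurable n hB), one_mul]
  -- The Poisson law is given only on sets of finite intensity, so the two measures are compared on
  -- the spanning sets.
  rw [Measure.ext_iff_of_iUnion_eq_univ (iUnion_spanningSets Λ)]
  intro i
  ext B hB
  rw [Measure.restrict_apply hB, Measure.restrict_apply hB]
  refine key _ (hB.inter (measurableSet_spanningSets Λ i)) (ne_top_of_le_ne_top
    (measure_spanningSets_lt_top Λ i).ne (measure_mono Set.inter_subset_right))

theorem tsum_lintegral [SigmaFinite Λ] (h : IsPoissonProcess P Λ X) {f : E → ℝ≥0∞}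
    (hf : Measurable f) : ∑' n, ∫⁻ ω, f (X n ω) ∂P = ∫⁻ x, f x ∂Λ := by
  conv_rhs => rw [← h.sum_map_eq, lintegral_sum_measure]
  congr with n
  rw [lintegral_map hf (h.measurable n)]

open Classical in
-- A finite mean count leaves almost surely finitely many points in `B`, so some initial segment of
-- indices contains them all. The floor only reads the extended real count as a natural number.
theorem ae_eventually_card_eq (h : IsPoissonProcess P Λ X) {B : Set E} (hB : MeasurableSet B)
    (hΛ : Λ B ≠ ∞) :
    ∀ᵐ ω ∂P, ∀ᶠ k in atTop,
      ((Finset.range k).filter fun n => X n ω ∈ B).card = ⌊(pointCount X B ω).toReal⌋₊ := by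
  have hfin : ∀ᵐ ω ∂P, pointCount X B ω < ∞ :=
    ae_lt_top (h.measurable_pointCount hB) (by rw [h.lintegral_pointCount hB hΛ]; exact hΛ)
  filter_upwards [hfin] with ω hω
  have hS : {n | X n ω ∈ B}.Finite := by
    refine (ENNReal.finite_const_le_of_tsum_ne_top hω.ne one_ne_zero).subset fun n hn => ?_
    simp only [Set.mem_ofPred_eq] at hn ⊢
    rw [Set.indicator_of_mem hn]
  have hcount : pointCount X B ω = hS.toFinset.card := by
    unfold pointCount
    rw [tsum_eq_sum (s := hS.toFinset)]
    · rw [Finset.sum_congr rfl (g := fun _ => 1)]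
      · simp
      · intro n hn
        exact Set.indicator_of_mem (by simpa using hn) _
    · intro n hn
      exact Set.indicator_of_notMem (by simpa using hn) _
  rw [hcount]
  obtain ⟨m, hm⟩ := hS.bddAbove
  filter_upwards [eventually_gt_atTop m] with k hk
  simp only [ENNReal.toReal_natCast, Nat.floor_natCast]
  congr 1
  ext n
  simp only [Finset.mem_filter, Finset.mem_range, Set.Finite.mem_toFinset, Set.mem_ofPred_eq,
    and_iff_right_iff_imp]
  exact fun hn => (hm hn).trans_lt hk

theorem integral_pow_pointCount (h : IsPoissonProcess P Λ X) {B : Set E} (hB : MeasurableSet B)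
    (hΛ : Λ B ≠ ∞) (c : ℝ) :
    ∫ ω, c ^ ⌊(pointCount X B ω).toReal⌋₊ ∂P = Real.exp (-((1 - c) * (Λ B).toReal)) := by
  have hm : Measurable fun x : ℝ≥0∞ => c ^ ⌊x.toReal⌋₊ :=
    measurable_from_nat.comp (Nat.measurable_floor.comp ENNReal.measurable_toReal)
  have h1 := (h.poisson B hB hΛ).integral_comp (f := fun x => c ^ ⌊x.toReal⌋₊)
    hm.aestronglyMeasurable
  simp only [Function.comp_def] at h1
  rw [h1, integral_map measurable_from_nat.aemeasurable hm.aestronglyMeasurable]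
  simp only [ENNReal.toReal_natCast, Nat.floor_natCast]
  rw [integral_pow_poissonMeasure]
  rfl

/-- Grouping factors by the value `c` of `φ` gives `∏ (1 - c) ^ (count of the level set of c)`. The
level sets are disjoint, so in the limit the counts are independent Poisson and each contributes
`exp (-c Λ)`. -/
theorem tendsto_integral_prod_simpleFunc [IsProbabilityMeasure P] (h : IsPoissonProcess P Λ X)
    (φ : SimpleFunc E ℝ≥0) (h1 : ∀ x, φ x ≤ 1) (hφ : ∫⁻ x, φ x ∂Λ ≠ ∞) :
    Tendsto (fun k => ∫ ω, ∏ n ∈ Finset.range k, (1 - (φ (X n ω) : ℝ)) ∂P) atTop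
      (𝓝 (Real.exp (-(∫⁻ x, φ x ∂Λ).toReal))) := by
  classical
  -- The value 0 is dropped: its factor is 1, and its level set may have infinite intensity. The
  -- other level sets are finite by Markov's inequality.
  set V : Finset ℝ≥0 := φ.range.filter (· ≠ 0) with hV
  have hB : ∀ c : ℝ≥0, MeasurableSet (φ ⁻¹' {c}) := fun c => φ.measurableSet_fiber c
  have hΛ : ∀ c ∈ V, Λ (φ ⁻¹' {c}) ≠ ∞ := by
    intro c hc
    have hc0 : c ≠ 0 := (Finset.mem_filter.1 hc).2
    refine ne_top_of_le_ne_top ?_ (measure_mono (t := {x | (c : ℝ≥0∞) ≤ φ x}) ?_)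
    · exact ne_top_of_le_ne_top (ENNReal.div_ne_top hφ (by simpa using hc0))
        (meas_ge_le_lintegral_div φ.measurable.coe_nnreal_ennreal.aemeasurable
          (by simpa using hc0) ENNReal.coe_ne_top)
    · intro x hx
      simp only [Set.mem_preimage, Set.mem_singleton_iff] at hx
      simp [hx]
  have hprod : ∀ k ω, ∏ n ∈ Finset.range k, (1 - (φ (X n ω) : ℝ)) =
      ∏ c ∈ V, (1 - (c : ℝ)) ^ ((Finset.range k).filter fun n => X n ω ∈ φ ⁻¹' {c}).card := by
    intro k ω
    have : ∀ n, 1 - (φ (X n ω) : ℝ) = ∏ c ∈ V, if φ (X n ω) = c then 1 - (c : ℝ) else 1 := by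
      intro n
      rw [Finset.prod_ite_eq]
      split_ifs with hn
      · rfl
      · have : φ (X n ω) = 0 := by
          by_contra h0
          exact hn (Finset.mem_filter.2 ⟨φ.mem_range_self _, h0⟩)
        simp [this]
    simp_rw [this]
    rw [Finset.prod_comm]
    refine Finset.prod_congr rfl fun c _ => ?_
    rw [Finset.prod_ite, Finset.prod_const, Finset.prod_const_one, mul_one]
    simp only [Set.mem_preimage, Set.mem_singleton_iff]
  have hc1 : ∀ c ∈ V, (1 - (c : ℝ)) ∈ Set.Icc (0 : ℝ) 1 := by
    intro c hc
    obtain ⟨x, rfl⟩ := SimpleFunc.mem_range.1 (Finset.mem_filter.1 hc).1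
    have := h1 x
    rw [← NNReal.coe_le_coe] at this
    exact ⟨sub_nonneg.2 this, by simp⟩
  have hlim : ∫ ω, ∏ c ∈ V, (1 - (c : ℝ)) ^ ⌊(pointCount X (φ ⁻¹' {c}) ω).toReal⌋₊ ∂P =
      Real.exp (-(∫⁻ x, φ x ∂Λ).toReal) := by
    have hind := (h.indep V.card (fun i => φ ⁻¹' {(V.equivFin.symm i : ℝ≥0)}) (fun i => hB _)
      fun i j hij => (Set.disjoint_singleton.2 fun e =>
        hij (V.equivFin.symm.injective (Subtype.ext e))).preimage _).precomp V.equivFin.injective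
    simp only [Equiv.symm_apply_apply] at hind
    have hm : ∀ c : ℝ, Measurable fun x : ℝ≥0∞ => c ^ ⌊x.toReal⌋₊ := fun c =>
      measurable_from_nat.comp (Nat.measurable_floor.comp ENNReal.measurable_toReal)
    have hind2 := hind.comp (fun (c : V) x => (1 - ((c : ℝ≥0) : ℝ)) ^ ⌊x.toReal⌋₊) fun c => hm _
    have hint := hind2.integral_fun_prod_eq_prod_integral fun c =>
      ((hm _).comp (h.measurable_pointCount (hB _))).aestronglyMeasurable
    simp only [Function.comp_def] at hint
    rw [Finset.prod_coe_sort V (fun c => ∫ ω, (1 - (c : ℝ)) ^ ⌊(pointCount X (φ ⁻¹' {c}) ω).toReal⌋₊ ∂P)]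
      at hint
    rw [← Finset.prod_congr rfl fun c hc => (h.integral_pow_pointCount (hB c) (hΛ c hc) _).symm]
      at hint
    simp_rw [← Finset.prod_coe_sort V]
    rw [hint, ← Real.exp_sum, Finset.sum_neg_distrib]
    congr 2
    have : ∫⁻ x, φ x ∂Λ = ∑ c ∈ V, (c : ℝ≥0∞) * Λ (φ ⁻¹' {c}) := by
      rw [show (fun x => (φ x : ℝ≥0∞)) = fun x => (φ.map ((↑) : ℝ≥0 → ℝ≥0∞)) x from rfl,
        SimpleFunc.lintegral_eq_lintegral, SimpleFunc.map_lintegral, hV,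
        Finset.sum_filter_of_ne]
      intro c _ hc h0
      simp [h0] at hc
    rw [this, ENNReal.toReal_sum fun c hc => ENNReal.mul_ne_top ENNReal.coe_ne_top (hΛ c hc)]
    refine Finset.sum_congr rfl fun c _ => ?_
    rw [ENNReal.toReal_mul, ENNReal.coe_toReal]
    ring
  rw [← hlim]
  refine tendsto_integral_of_dominated_convergence (fun _ => 1) ?_ (integrable_const _) ?_ ?_
  · intro k
    refine Measurable.aestronglyMeasurable (Finset.measurable_prod _ fun n _ => ?_)
    exact measurable_const.sub (φ.measurable.comp (h.measurable n)).coe_nnreal_real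
  · intro k
    refine .of_forall fun ω => ?_
    rw [hprod, Real.norm_eq_abs, Finset.abs_prod]
    refine Finset.prod_le_one (fun _ _ => abs_nonneg _) fun c hc => ?_
    rw [abs_of_nonneg (pow_nonneg (hc1 c hc).1 _)]
    exact pow_le_one₀ (hc1 c hc).1 (hc1 c hc).2
  · have hev : ∀ᵐ ω ∂P, ∀ c ∈ V, ∀ᶠ k in atTop,
        ((Finset.range k).filter fun n => X n ω ∈ φ ⁻¹' {c}).card =
          ⌊(pointCount X (φ ⁻¹' {c}) ω).toReal⌋₊ :=
      (ae_ball_iff V.countable_toSet).2 fun c hc => by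
        filter_upwards [h.ae_eventually_card_eq (hB c) (hΛ c hc)] with ω hω
        convert! hω
    filter_upwards [hev] with ω hω
    refine tendsto_const_nhds.congr' ?_
    filter_upwards [(Finset.eventually_all V).2 hω] with k hk
    rw [hprod]
    exact Finset.prod_congr rfl fun c hc => by rw [hk c hc]

end IsPoissonProcess

end UavNetwork

/-! ### The generating functional for general functions. -/

namespace UavNetwork

open Filter Topology
open scoped NNReal

theorem exists_simpleFunc_le_lintegral_sub_le {E : Type*} [MeasurableSpace E] {Λ : Measure E}
    {u : E → ℝ≥0} (hfin : ∫⁻ x, u x ∂Λ ≠ ∞) {ε : ℝ≥0∞} (hε : ε ≠ 0) :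
    ∃ φ : SimpleFunc E ℝ≥0, (∀ x, φ x ≤ u x) ∧ ∫⁻ x, (u x - φ x : ℝ≥0) ∂Λ ≤ ε := by
  obtain ⟨φ, h1, h2⟩ : ∃ φ : SimpleFunc E ℝ≥0, (∀ x, φ x ≤ u x) ∧
      ∫⁻ x, u x ∂Λ ≤ ∫⁻ x, φ x ∂Λ + ε := by
    rcases eq_or_ne (∫⁻ x, (u x : ℝ≥0∞) ∂Λ) 0 with h0 | h0
    · exact ⟨0, fun x => bot_le, by simp [h0]⟩
    have hlt := ENNReal.sub_lt_self hfin h0 hε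
    conv_rhs at hlt => rw [lintegral_eq_nnreal]
    obtain ⟨φ, hlt⟩ := lt_iSup_iff.1 hlt
    obtain ⟨h1, hlt⟩ := lt_iSup_iff.1 hlt
    refine ⟨φ, fun x => ENNReal.coe_le_coe.1 (h1 x), ?_⟩
    rw [← SimpleFunc.lintegral_eq_lintegral] at hlt
    exact tsub_le_iff_right.1 hlt.le
  refine ⟨φ, h1, ?_⟩
  simp_rw [ENNReal.coe_sub]
  rw [lintegral_sub φ.measurable.coe_nnreal_ennreal
    (ne_top_of_le_ne_top hfin (lintegral_mono fun x => ENNReal.coe_le_coe.2 (h1 x)))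
    (.of_forall fun x => ENNReal.coe_le_coe.2 (h1 x))]
  exact tsub_le_iff_left.2 h2

variable {Ω E F : Type*} [MeasurableSpace Ω] [MeasurableSpace E] [MeasurableSpace F]
  {P : Measure Ω} {Λ : Measure E} {ν : Measure F} {X : ℕ → Ω → E} {T : ℕ → Ω → F}

namespace IsPoissonProcess

/-- The bound does not depend on `k`, which is what allows approximation by simple functions before
the limit in `k` is taken. -/
theorem abs_integral_prod_sub_le [IsProbabilityMeasure P] [SigmaFinite Λ]
    (h : IsPoissonProcess P Λ X) {u w : E → ℝ≥0} (hu : Measurable u) (hw : Measurable w)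
    (h1 : ∀ x, u x ≤ 1) (hwu : ∀ x, w x ≤ u x) (k : ℕ) :
    ENNReal.ofReal |∫ ω, ∏ n ∈ Finset.range k, (1 - (u (X n ω) : ℝ)) ∂P -
      ∫ ω, ∏ n ∈ Finset.range k, (1 - (w (X n ω) : ℝ)) ∂P| ≤ ∫⁻ x, (u x - w x : ℝ≥0) ∂Λ := by
  have hmem : ∀ (w : E → ℝ≥0), (∀ x, w x ≤ 1) → ∀ x, (1 - (w x : ℝ)) ∈ Set.Icc (0 : ℝ) 1 :=
    fun w hw x => ⟨sub_nonneg.2 (by exact_mod_cast hw x), by simp⟩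
  have hint : ∀ (w : E → ℝ≥0), Measurable w → (∀ x, w x ≤ 1) →
      Integrable (fun ω => ∏ n ∈ Finset.range k, (1 - (w (X n ω) : ℝ))) P := by
    intro w hw hw1
    refine Integrable.of_bound (C := 1) (Measurable.aestronglyMeasurable
      (Finset.measurable_prod _ fun n _ =>
        measurable_const.sub (hw.comp (h.measurable n)).coe_nnreal_real)) (.of_forall fun ω => ?_)
    rw [Real.norm_eq_abs, Finset.abs_prod]
    refine Finset.prod_le_one (fun _ _ => abs_nonneg _) fun n _ => ?_
    rw [abs_of_nonneg (hmem w hw1 _).1]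
    exact (hmem w hw1 _).2
  have hw1 : ∀ x, w x ≤ 1 := fun x => (hwu x).trans (h1 x)
  rw [← integral_sub (hint u hu h1) (hint w hw hw1), ← Real.norm_eq_abs, ofReal_norm]
  refine (enorm_integral_le_lintegral_enorm _).trans ?_
  calc ∫⁻ ω, ‖∏ n ∈ Finset.range k, (1 - (u (X n ω) : ℝ)) -
        ∏ n ∈ Finset.range k, (1 - (w (X n ω) : ℝ))‖ₑ ∂P
      ≤ ∫⁻ ω, ∑ n ∈ Finset.range k, ((u (X n ω) - w (X n ω) : ℝ≥0) : ℝ≥0∞) ∂P := by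
        refine lintegral_mono fun ω => ?_
        rw [← ofReal_norm, Real.norm_eq_abs]
        have := abs_prod_sub_prod_le (Finset.range k) (fun n => hmem u h1 (X n ω))
          (fun n => hmem w hw1 (X n ω))
        refine (ENNReal.ofReal_le_ofReal this).trans_eq ?_
        rw [ENNReal.ofReal_sum_of_nonneg fun _ _ => abs_nonneg _]
        refine Finset.sum_congr rfl fun n _ => ?_
        rw [← ENNReal.ofReal_coe_nnreal, NNReal.coe_sub (hwu _), abs_sub_comm,
          sub_sub_sub_cancel_left, abs_of_nonneg (sub_nonneg.2 (by exact_mod_cast hwu _))]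
    _ = ∑ n ∈ Finset.range k, ∫⁻ ω, ((u (X n ω) - w (X n ω) : ℝ≥0) : ℝ≥0∞) ∂P :=
        lintegral_finsetSum _ fun n _ =>
          ((hu.sub hw).comp (h.measurable n)).coe_nnreal_ennreal
    _ ≤ ∑' n, ∫⁻ ω, ((u (X n ω) - w (X n ω) : ℝ≥0) : ℝ≥0∞) ∂P := ENNReal.sum_le_tsum _
    _ = ∫⁻ x, (u x - w x : ℝ≥0) ∂Λ :=
        h.tsum_lintegral (f := fun x => ((u x - w x : ℝ≥0) : ℝ≥0∞))
          (hu.sub hw).coe_nnreal_ennreal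

/-- The probability generating functional of a Poisson process. -/
theorem tendsto_integral_prod [IsProbabilityMeasure P] [SigmaFinite Λ]
    (h : IsPoissonProcess P Λ X) {u : E → ℝ≥0} (hu : Measurable u) (h1 : ∀ x, u x ≤ 1)
    (hfin : ∫⁻ x, u x ∂Λ ≠ ∞) :
    Tendsto (fun k => ∫ ω, ∏ n ∈ Finset.range k, (1 - (u (X n ω) : ℝ)) ∂P) atTop
      (𝓝 (Real.exp (-(∫⁻ x, u x ∂Λ).toReal))) := by
  rw [Metric.tendsto_nhds]
  intro ε hε
  -- Three errors of at most `ε / 4` each: `u` against `φ` in the products, `u` against `φ` in the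
  -- exponentials, and the limit for `φ`.
  obtain ⟨φ, hφ, hle⟩ := exists_simpleFunc_le_lintegral_sub_le hfin
    (ε := ENNReal.ofReal (ε / 4)) (by simpa using hε)
  have hφfin : ∫⁻ x, φ x ∂Λ ≠ ∞ :=
    ne_top_of_le_ne_top hfin (lintegral_mono fun x => ENNReal.coe_le_coe.2 (hφ x))
  have hexp : |Real.exp (-(∫⁻ x, φ x ∂Λ).toReal) - Real.exp (-(∫⁻ x, u x ∂Λ).toReal)| ≤ ε / 4 := by
    have hsub : (∫⁻ x, u x ∂Λ).toReal - (∫⁻ x, φ x ∂Λ).toReal ≤ ε / 4 := by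
      rw [sub_le_iff_le_add, ← ENNReal.toReal_ofReal (by positivity : 0 ≤ ε / 4),
        ← ENNReal.toReal_add ENNReal.ofReal_ne_top hφfin]
      refine ENNReal.toReal_mono (by finiteness) ?_
      refine le_trans (le_of_eq ?_) (add_le_add_left hle _)
      rw [← lintegral_add_right _ φ.measurable.coe_nnreal_ennreal]
      congr with x
      rw [← ENNReal.coe_add, tsub_add_cancel_of_le (hφ x)]
    have hmono : (∫⁻ x, φ x ∂Λ).toReal ≤ (∫⁻ x, u x ∂Λ).toReal :=
      ENNReal.toReal_mono hfin (lintegral_mono fun x => ENNReal.coe_le_coe.2 (hφ x))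
    set a := (∫⁻ x, φ x ∂Λ).toReal with ha
    set b := (∫⁻ x, u x ∂Λ).toReal
    have ha0 : 0 ≤ a := ENNReal.toReal_nonneg
    rw [abs_of_nonneg (sub_nonneg.2 (Real.exp_le_exp.2 (by linarith)))]
    -- `exp (-·)` is 1-Lipschitz on the nonnegative reals.
    have h2 : Real.exp (-b) = Real.exp (-a) * Real.exp (a - b) := by
      rw [← Real.exp_add]; congr 1; ring
    have h3 := Real.add_one_le_exp (a - b)
    have h4 : Real.exp (-a) ≤ 1 := Real.exp_le_one_iff.2 (by linarith)
    have h5 := Real.exp_pos (-a)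
    rw [h2]
    nlinarith
  have hlim := h.tendsto_integral_prod_simpleFunc φ (fun x => (hφ x).trans (h1 x)) hφfin
  rw [Metric.tendsto_nhds] at hlim
  filter_upwards [hlim (ε / 4) (by positivity)] with k hk
  have hdiff := (h.abs_integral_prod_sub_le hu φ.measurable h1 hφ k).trans hle
  rw [ENNReal.ofReal_le_ofReal_iff (by positivity)] at hdiff
  rw [Real.dist_eq] at hk ⊢
  rw [abs_le] at hdiff hexp
  rw [abs_lt] at hk ⊢
  constructor <;> linarith [hdiff.1, hdiff.2, hexp.1, hexp.2, hk.1, hk.2]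

end IsPoissonProcess

/-! ### Independent marks and the Laplace functional. -/

namespace IsIndependentMarking

/-- With the points frozen, the marks are still independent with law `ν`, so the inner integral
factorizes. What remains is a product in the points alone, to which the generating functional
applies. -/
theorem integral_prod_eq [IsProbabilityMeasure P] [IsProbabilityMeasure ν]
    (hX : ∀ n, Measurable (X n)) (h : IsIndependentMarking P ν X T) {ψ : E → F → ℝ}
    (hψ : Measurable (Function.uncurry ψ)) (h01 : ∀ x t, ψ x t ∈ Set.Icc 0 1) (k : ℕ) :
    ∫ ω, ∏ n ∈ Finset.range k, ψ (X n ω) (T n ω) ∂P =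
      ∫ ω, ∏ n ∈ Finset.range k, ∫ t, ψ (X n ω) t ∂ν ∂P := by
  have hXs : Measurable fun ω n => X n ω := measurable_pi_lambda _ hX
  have hTs : Measurable fun ω n => T n ω := measurable_pi_lambda _ h.measurable
  have hm : Measurable fun q : (ℕ → E) × (ℕ → F) =>
      ∏ n ∈ Finset.range k, ψ (q.1 n) (q.2 n) := by
    refine Finset.measurable_prod _ fun n _ => ?_
    have : Measurable fun q : (ℕ → E) × (ℕ → F) => (q.1 n, q.2 n) := by fun_prop
    exact hψ.comp this
  have hv : Measurable fun x => ∫ t, ψ x t ∂ν :=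
    (hψ.stronglyMeasurable.integral_prod_right (ν := ν)).measurable
  have hpX := Measure.isProbabilityMeasure_map (μ := P) hXs.aemeasurable
  have hpT := Measure.isProbabilityMeasure_map (μ := P) hTs.aemeasurable
  have hmap := h.indep_points.map_prod_eq_prod_map_map hXs.aemeasurable hTs.aemeasurable
  have hL := integral_map (μ := P) (hXs.prodMk hTs).aemeasurable
    (f := fun q : (ℕ → E) × (ℕ → F) => ∏ n ∈ Finset.range k, ψ (q.1 n) (q.2 n))
    hm.aestronglyMeasurable
  have hR := integral_map (μ := P) hXs.aemeasurable
    (f := fun x : ℕ → E => ∏ n ∈ Finset.range k, ∫ t, ψ (x n) t ∂ν)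
    (Measurable.aestronglyMeasurable
      (Finset.measurable_prod _ fun n _ => hv.comp (measurable_pi_apply n)))
  rw [← hL, ← hR, hmap, integral_prod]
  · congr with x
    have hmx : Measurable fun t : ℕ → F => ∏ n ∈ Finset.range k, ψ (x n) (t n) :=
      hm.comp (measurable_const.prodMk measurable_id)
    rw [integral_map hTs.aemeasurable hmx.aestronglyMeasurable]
    simp_rw [Finset.prod_range]
    have hind := (h.indep.precomp (g := ((↑) : Fin k → ℕ)) Fin.val_injective).comp
      (fun n t => ψ (x n) t) fun n => hψ.of_uncurry_left
    have := hind.integral_fun_prod_eq_prod_integral fun n =>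
      ((hψ.of_uncurry_left).comp (h.measurable n)).aestronglyMeasurable
    simp only [Function.comp_def] at this
    rw [this]
    refine Finset.prod_congr rfl fun n _ => ?_
    exact (h.law n).integral_comp (f := fun t => ψ (x n) t)
      (hψ.of_uncurry_left).aestronglyMeasurable
  · refine Integrable.of_bound (C := 1) hm.aestronglyMeasurable (.of_forall fun q => ?_)
    rw [Real.norm_eq_abs, Finset.abs_prod]
    refine Finset.prod_le_one (fun _ _ => abs_nonneg _) fun n _ => ?_
    rw [abs_of_nonneg (h01 _ _).1]
    exact (h01 _ _).2

theorem lintegral_eq [IsProbabilityMeasure P] [IsProbabilityMeasure ν]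
    (hX : ∀ n, Measurable (X n)) (h : IsIndependentMarking P ν X T) {f : E → F → ℝ≥0∞}
    (hf : Measurable (Function.uncurry f)) (n : ℕ) :
    ∫⁻ ω, f (X n ω) (T n ω) ∂P = ∫⁻ ω, ∫⁻ t, f (X n ω) t ∂ν ∂P := by
  have hi : IndepFun (X n) (T n) P :=
    h.indep_points.comp (measurable_pi_apply n) (measurable_pi_apply n)
  have hmap := hi.map_prod_eq_prod_map_map (hX n).aemeasurable (h.measurable n).aemeasurable
  rw [(h.law n).map_eq] at hmap
  have hL := lintegral_map (μ := P) hf ((hX n).prodMk (h.measurable n))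
  have hR := lintegral_map (μ := P) (f := fun x => ∫⁻ t, f x t ∂ν) hf.lintegral_prod_right' (hX n)
  simp only [Function.uncurry_apply_pair] at hL
  rw [← hL, ← hR, hmap, lintegral_prod _ hf.aemeasurable]
  rfl

end IsIndependentMarking

/-- The total `∑ f(X_n, T_n)` over an independently marked Poisson process converges almost surely
when its mean is finite. -/
theorem ae_summable_marked [IsProbabilityMeasure P] [IsProbabilityMeasure ν] [SigmaFinite Λ]
    (hX : IsPoissonProcess P Λ X) (hT : IsIndependentMarking P ν X T) {f : E → F → ℝ}
    (hf : Measurable (Function.uncurry f)) (h0 : ∀ x t, 0 ≤ f x t)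
    (hfin : ∫⁻ x, ∫⁻ t, ENNReal.ofReal (f x t) ∂ν ∂Λ ≠ ∞) :
    ∀ᵐ ω ∂P, Summable fun n => f (X n ω) (T n ω) := by
  have hfm : Measurable (Function.uncurry fun x t => ENNReal.ofReal (f x t)) :=
    ENNReal.measurable_ofReal.comp hf
  have hm : ∀ n, Measurable fun ω => ENNReal.ofReal (f (X n ω) (T n ω)) := fun n =>
    hfm.comp ((hX.measurable n).prodMk (hT.measurable n))
  have hint : ∫⁻ ω, ∑' n, ENNReal.ofReal (f (X n ω) (T n ω)) ∂P ≠ ∞ := by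
    rw [lintegral_tsum fun n => (hm n).aemeasurable]
    simp_rw [hT.lintegral_eq hX.measurable hfm]
    rwa [hX.tsum_lintegral (f := fun x => ∫⁻ t, ENNReal.ofReal (f x t) ∂ν)
      hfm.lintegral_prod_right']
  filter_upwards [ae_lt_top (Measurable.tsum hm) hint] with ω hω
  have := ENNReal.summable_toReal hω.ne
  simpa only [ENNReal.toReal_ofReal (h0 _ _)] using this

/-- From `1 - exp (-y) ≤ y`: a finite mean total makes the exponent of the Laplace functional
finite. -/
theorem lintegral_one_sub_integral_exp_le [IsProbabilityMeasure ν] {f : E → F → ℝ}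
    (hf : Measurable (Function.uncurry f)) (h0 : ∀ x t, 0 ≤ f x t) (x : E) :
    ENNReal.ofReal (1 - ∫ t, Real.exp (-f x t) ∂ν) ≤ ∫⁻ t, ENNReal.ofReal (f x t) ∂ν := by
  have hm : Measurable (f x) := hf.of_uncurry_left
  have hint : Integrable (fun t => Real.exp (-f x t)) ν :=
    Integrable.of_bound (C := 1) (by fun_prop) (.of_forall fun t => by
      rw [Real.norm_eq_abs, abs_of_pos (Real.exp_pos _)]
      exact Real.exp_le_one_iff.2 (neg_nonpos.2 (h0 x t)))
  have : 1 - ∫ t, Real.exp (-f x t) ∂ν = ∫ t, (1 - Real.exp (-f x t)) ∂ν := by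
    rw [integral_sub (integrable_const _) hint]
    simp
  have hint2 : Integrable (fun t => 1 - Real.exp (-f x t)) ν := (integrable_const _).sub hint
  rw [this, ofReal_integral_eq_lintegral_ofReal hint2
    (.of_forall fun t => sub_nonneg.2 (Real.exp_le_one_iff.2 (neg_nonpos.2 (h0 x t))))]
  refine lintegral_mono fun t => ENNReal.ofReal_le_ofReal ?_
  linarith [Real.add_one_le_exp (-f x t)]

theorem integral_exp_neg_mem_Icc [IsProbabilityMeasure ν] {g : F → ℝ} (h0 : ∀ t, 0 ≤ g t) :
    ∫ t, Real.exp (-g t) ∂ν ∈ Set.Icc (0 : ℝ) 1 := by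
  refine ⟨integral_nonneg fun t => (Real.exp_pos _).le, ?_⟩
  refine (integral_mono_of_nonneg (g := fun _ => 1) (.of_forall fun t => (Real.exp_pos _).le)
    (integrable_const _) (.of_forall fun t => ?_)).trans_eq (by simp)
  exact Real.exp_le_one_iff.2 (neg_nonpos.2 (h0 t))

theorem integrable_one_sub_integral_exp [IsProbabilityMeasure ν] {f : E → F → ℝ}
    (hf : Measurable (Function.uncurry f)) (h0 : ∀ x t, 0 ≤ f x t)
    (hfin : ∫⁻ x, ∫⁻ t, ENNReal.ofReal (f x t) ∂ν ∂Λ ≠ ∞) :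
    Integrable (fun x => 1 - ∫ t, Real.exp (-f x t) ∂ν) Λ := by
  have hexp : Measurable (Function.uncurry fun x t => Real.exp (-f x t)) :=
    Real.measurable_exp.comp hf.neg
  have hv : Measurable fun x => ∫ t, Real.exp (-f x t) ∂ν :=
    (hexp.stronglyMeasurable.integral_prod_right (ν := ν)).measurable
  refine ⟨(measurable_const.sub hv).aestronglyMeasurable, ?_⟩
  rw [hasFiniteIntegral_iff_ofReal
    (.of_forall fun x => sub_nonneg.2 (integral_exp_neg_mem_Icc (h0 x)).2)]
  exact (lintegral_mono fun x => lintegral_one_sub_integral_exp_le hf h0 x).trans_lt hfin.lt_top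

/-- The Laplace functional of an independently marked Poisson process. -/
theorem integral_exp_neg_tsum_marked [IsProbabilityMeasure P] [IsProbabilityMeasure ν]
    [SigmaFinite Λ] (hX : IsPoissonProcess P Λ X) (hT : IsIndependentMarking P ν X T)
    {f : E → F → ℝ} (hf : Measurable (Function.uncurry f)) (h0 : ∀ x t, 0 ≤ f x t)
    (hfin : ∫⁻ x, ∫⁻ t, ENNReal.ofReal (f x t) ∂ν ∂Λ ≠ ∞) :
    ∫ ω, Real.exp (-∑' n, f (X n ω) (T n ω)) ∂P =
      Real.exp (-∫ x, (1 - ∫ t, Real.exp (-f x t) ∂ν) ∂Λ) := by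
  have hexp : Measurable (Function.uncurry fun x t => Real.exp (-f x t)) :=
    Real.measurable_exp.comp hf.neg
  have hv : Measurable fun x => ∫ t, Real.exp (-f x t) ∂ν :=
    (hexp.stronglyMeasurable.integral_prod_right (ν := ν)).measurable
  have hmem := fun x => integral_exp_neg_mem_Icc (ν := ν) (h0 x)
  have hu0 : ∀ x, 0 ≤ 1 - ∫ t, Real.exp (-f x t) ∂ν := fun x => sub_nonneg.2 (hmem x).2
  have hlim1 : Tendsto (fun k => ∫ ω, ∏ n ∈ Finset.range k, Real.exp (-f (X n ω) (T n ω)) ∂P)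
      atTop (𝓝 (∫ ω, Real.exp (-∑' n, f (X n ω) (T n ω)) ∂P)) := by
    refine tendsto_integral_of_dominated_convergence (fun _ => 1) ?_ (integrable_const _) ?_ ?_
    · intro k
      exact Measurable.aestronglyMeasurable (Finset.measurable_prod _ fun n _ =>
        hexp.comp ((hX.measurable n).prodMk (hT.measurable n)))
    · intro k
      refine .of_forall fun ω => ?_
      rw [Real.norm_eq_abs, Finset.abs_prod]
      refine Finset.prod_le_one (fun _ _ => abs_nonneg _) fun n _ => ?_
      rw [abs_of_pos (Real.exp_pos _)]
      exact Real.exp_le_one_iff.2 (neg_nonpos.2 (h0 _ _))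
    · filter_upwards [ae_summable_marked hX hT hf h0 hfin] with ω hω
      simp_rw [← Real.exp_sum, Finset.sum_neg_distrib]
      exact (Real.continuous_exp.tendsto _).comp hω.hasSum.tendsto_sum_nat.neg
  have hprod := fun k => hT.integral_prod_eq hX.measurable hexp
    (fun x t => ⟨(Real.exp_pos _).le, Real.exp_le_one_iff.2 (neg_nonpos.2 (h0 x t))⟩) k
  -- With this `u` the factors `1 - u` are the mark averages in `hprod`, so `hlim1` and `hlim2` are
  -- limits of one sequence.
  have hlim2 := hX.tendsto_integral_prod (u := fun x => (1 - ∫ t, Real.exp (-f x t) ∂ν).toNNReal)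
    (measurable_const.sub hv).real_toNNReal
    (fun x => Real.toNNReal_le_one.2 (by linarith [(hmem x).1]))
    (ne_top_of_le_ne_top hfin
      (lintegral_mono fun x => lintegral_one_sub_integral_exp_le hf h0 x))
  simp only [Real.coe_toNNReal _ (hu0 _), sub_sub_cancel] at hlim2
  rw [tendsto_nhds_unique (hlim1.congr hprod) hlim2,
    integral_eq_lintegral_of_nonneg_ae (.of_forall hu0)
      (measurable_const.sub hv).aestronglyMeasurable]
  rfl

end UavNetwork

/-! ### Plane geometry: averaging a radial function over an off-centre disc. -/

namespace UavNetwork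

open Filter Topology
open scoped NNReal

/-- Up to endpoints the set is the interval of half-length `arccos c`. It is squeezed between an
open and a closed interval so that every real `c` is covered: `Real.arccos` is 0 above 1, where the
set is empty, and π below -1, where it is everything. -/
theorem volume_setOf_le_cos (c : ℝ) :
    (volume.restrict (Set.Ioo (-Real.pi) Real.pi)) {θ : ℝ | c ≤ Real.cos θ} =
      ENNReal.ofReal (2 * Real.arccos c) := by
  rw [Measure.restrict_apply (measurableSet_le measurable_const Real.measurable_cos)]
  refine le_antisymm ?_ ?_
  · refine (measure_mono (t := Set.Icc (-Real.arccos c) (Real.arccos c)) ?_).trans_eq ?_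
    · rintro θ ⟨hc, h1, h2⟩
      rw [Set.mem_ofPred_eq, ← Real.cos_abs] at hc
      rw [Set.mem_Icc, ← abs_le, ← Real.arccos_cos (abs_nonneg θ) (abs_le.2 ⟨h1.le, h2.le⟩)]
      exact Real.arccos_le_arccos hc
    · rw [Real.volume_Icc]; congr 1; ring
  · refine le_trans (le_of_eq ?_) (measure_mono (s := Set.Ioo (-Real.arccos c) (Real.arccos c)) ?_)
    · rw [Real.volume_Ioo]; congr 1; ring
    · intro θ hθ
      rw [Set.mem_Ioo, ← abs_lt] at hθ
      have hpi := hθ.trans_le (Real.arccos_le_pi c)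
      refine ⟨?_, abs_lt.1 hpi⟩
      rw [Set.mem_ofPred_eq, ← Real.cos_abs]
      by_contra! hlt
      have := Real.arccos_le_arccos hlt.le
      rw [Real.arccos_cos (abs_nonneg θ) hpi.le] at this
      linarith

theorem Plane.norm_eq_sqrt (y : Plane) : ‖y‖ = √(y 0 ^ 2 + y 1 ^ 2) := by
  rw [EuclideanSpace.norm_eq, Fin.sum_univ_two, Real.norm_eq_abs, Real.norm_eq_abs, sq_abs, sq_abs]

theorem Plane.measurePreserving_coords :
    MeasurePreserving (fun y : Plane => ((y 0, y 1) : ℝ × ℝ)) :=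
  (volume_preserving_finTwoArrow ℝ).comp (PiLp.volume_preserving_ofLp (Fin 2))

/-- Integrals of functions of two distances, to the origin and to another point, depend on the
latter only through its norm. -/
theorem lintegral_norm_norm_sub_congr {f : ℝ → ℝ → ℝ≥0∞} {x x' : Plane} (hx : ‖x‖ = ‖x'‖) :
    ∫⁻ y : Plane, f ‖y‖ ‖y - x‖ = ∫⁻ y : Plane, f ‖y‖ ‖y - x'‖ := by
  -- Reflection in the perpendicular bisector of `x` and `x'`; it fixes the origin because the norms
  -- agree.
  set L := (ℝ ∙ (x - x'))ᗮ.reflection with hL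
  have hLx : L x = x' := Submodule.reflection_sub hx
  rw [← L.measurePreserving.lintegral_comp_emb L.toHomeomorph.measurableEmbedding
    fun y => f ‖y‖ ‖y - x'‖]
  congr with y
  rw [← hLx, ← map_sub, L.norm_map, L.norm_map]

/-- The disc is translated to centre `x`, `x` is moved to the first axis, and polar coordinates
about the origin are used. By the law of cosines the point at radius `g` and angle `θ` is in the
disc exactly when `cos θ` is at least the argument of the arccosine. -/
theorem lintegral_closedBall_norm_add {k : ℝ → ℝ≥0∞} (hk : Measurable k) {R : ℝ} (hR : 0 ≤ R)
    {x : Plane} (hx : x ≠ 0) :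
    ∫⁻ y in Metric.closedBall (0 : Plane) R, k ‖x + y‖ =
      ∫⁻ g in Set.Ioi (0 : ℝ), k g *
        ENNReal.ofReal (g * (2 * Real.arccos ((g ^ 2 + ‖x‖ ^ 2 - R ^ 2) / (2 * g * ‖x‖)))) := by
  set q := ‖x‖ with hq
  have hq0 : 0 < q := norm_pos_iff.2 hx
  set f : ℝ → ℝ → ℝ≥0∞ := fun a b => (Set.Iic R).indicator (fun _ => k a) b with hf
  have hfm : Measurable (Function.uncurry f) := by
    have : Function.uncurry f = (Prod.snd ⁻¹' Set.Iic R).indicator fun p => k p.1 := by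
      ext p; rfl
    rw [this]
    exact (hk.comp measurable_fst).indicator (measurable_snd measurableSet_Iic)
  set x' : Plane := !₂[q, 0] with hx'
  have hxx : ‖x‖ = ‖x'‖ := by
    rw [Plane.norm_eq_sqrt x']; simp [hx', hq]
  have hset : MeasurableSet {p : ℝ × ℝ |
      (p.1 ^ 2 + q ^ 2 - R ^ 2) / (2 * p.1 * q) ≤ Real.cos p.2} :=
    measurableSet_le (by fun_prop) (by fun_prop)
  calc ∫⁻ y in Metric.closedBall (0 : Plane) R, k ‖x + y‖
      = ∫⁻ y : Plane, f ‖x + y‖ ‖x + y - x‖ := by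
        rw [← lintegral_indicator Metric.isClosed_closedBall.measurableSet]
        congr with y
        simp [hf, Set.indicator]
    _ = ∫⁻ y : Plane, f ‖y‖ ‖y - x‖ :=
        lintegral_add_left_eq_self (fun y : Plane => f ‖y‖ ‖y - x‖) x
    _ = ∫⁻ y : Plane, f ‖y‖ ‖y - x'‖ := lintegral_norm_norm_sub_congr hxx
    _ = ∫⁻ p : ℝ × ℝ, f √(p.1 ^ 2 + p.2 ^ 2) √((p.1 - q) ^ 2 + p.2 ^ 2) := by
        have hm : Measurable fun p : ℝ × ℝ =>
            f √(p.1 ^ 2 + p.2 ^ 2) √((p.1 - q) ^ 2 + p.2 ^ 2) :=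
          hfm.comp (by fun_prop : Measurable fun p : ℝ × ℝ =>
            (√(p.1 ^ 2 + p.2 ^ 2), √((p.1 - q) ^ 2 + p.2 ^ 2)))
        rw [← Plane.measurePreserving_coords.lintegral_comp hm]
        congr with y
        rw [Plane.norm_eq_sqrt, Plane.norm_eq_sqrt]
        simp [hx']
    _ = ∫⁻ p in Set.Ioi (0 : ℝ) ×ˢ Set.Ioo (-Real.pi) Real.pi, ENNReal.ofReal p.1 * k p.1 *
          {p : ℝ × ℝ | (p.1 ^ 2 + q ^ 2 - R ^ 2) / (2 * p.1 * q) ≤ Real.cos p.2}.indicator 1 p := by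
        rw [← lintegral_comp_polarCoord_symm]
        refine setLIntegral_congr_fun (measurableSet_Ioi.prod measurableSet_Ioo) fun p hp => ?_
        have hg : 0 < p.1 := hp.1
        simp only [polarCoord_symm_apply, smul_eq_mul]
        have h1 : √((p.1 * Real.cos p.2) ^ 2 + (p.1 * Real.sin p.2) ^ 2) = p.1 := by
          rw [show (p.1 * Real.cos p.2) ^ 2 + (p.1 * Real.sin p.2) ^ 2 =
            p.1 ^ 2 * (Real.sin p.2 ^ 2 + Real.cos p.2 ^ 2) by ring, Real.sin_sq_add_cos_sq,
            mul_one, Real.sqrt_sq hg.le]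
        have h2 : √((p.1 * Real.cos p.2 - q) ^ 2 + (p.1 * Real.sin p.2) ^ 2) ≤ R ↔
            (p.1 ^ 2 + q ^ 2 - R ^ 2) / (2 * p.1 * q) ≤ Real.cos p.2 := by
          rw [Real.sqrt_le_left hR, div_le_iff₀ (by positivity),
            show (p.1 * Real.cos p.2 - q) ^ 2 + (p.1 * Real.sin p.2) ^ 2 =
              p.1 ^ 2 * (Real.sin p.2 ^ 2 + Real.cos p.2 ^ 2) + q ^ 2 -
                2 * p.1 * q * Real.cos p.2 by ring, Real.sin_sq_add_cos_sq]
          constructor <;> intro h <;> linarith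
        rw [h1]
        simp only [hf, Set.indicator, Set.mem_Iic, h2, Set.mem_ofPred_eq, Pi.one_apply]
        split_ifs <;> simp
    _ = ∫⁻ g in Set.Ioi (0 : ℝ), k g *
        ENNReal.ofReal (g * (2 * Real.arccos ((g ^ 2 + q ^ 2 - R ^ 2) / (2 * g * q)))) := by
        rw [Measure.volume_eq_prod, ← Measure.prod_restrict, lintegral_prod]
        · refine setLIntegral_congr_fun measurableSet_Ioi fun g hg => ?_
          have hg : 0 < g := hg
          have hs : MeasurableSet {θ : ℝ | (g ^ 2 + q ^ 2 - R ^ 2) / (2 * g * q) ≤ Real.cos θ} :=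
            measurableSet_le measurable_const Real.measurable_cos
          simp only
          rw [lintegral_const_mul, ENNReal.ofReal_mul hg.le, ← volume_setOf_le_cos,
            ← lintegral_indicator_one hs]
          · rw [mul_comm (ENNReal.ofReal g), mul_assoc]
            rfl
          · exact measurable_one.indicator hs
        · exact (((by fun_prop : Measurable fun p : ℝ × ℝ => ENNReal.ofReal p.1).mul
            (hk.comp measurable_fst)).mul (measurable_one.indicator hset)).aemeasurable

/-! ### Gamma distribution: Laplace transform and mean. -/

theorem measurable_gammaPDF (a r : ℝ) : Measurable (gammaPDF a r) :=
  (measurable_gammaPDFReal a r).ennreal_ofReal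

theorem ae_nonneg_gammaMeasure (a r : ℝ) : ∀ᵐ x ∂gammaMeasure a r, 0 ≤ x := by
  have : {x : ℝ | ¬0 ≤ x} = Set.Iio 0 := by ext; simp
  rw [ae_iff, this, gammaMeasure, withDensity_apply _ measurableSet_Iio]
  exact lintegral_gammaPDF_of_nonpos le_rfl

/-- Exponential tilting: `exp (-t x)` times the density of rate `r` is a constant times the density
of rate `r + t`, which has mass one. -/
theorem lintegral_exp_neg_mul_gammaMeasure {a r t : ℝ} (ha : 0 < a) (hr : 0 < r) (ht : 0 ≤ t) :
    ∫⁻ x, ENNReal.ofReal (Real.exp (-(t * x))) ∂gammaMeasure a r =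
      ENNReal.ofReal ((1 + t / r) ^ (-a)) := by
  rw [gammaMeasure, lintegral_withDensity_eq_lintegral_mul _
    (measurable_gammaPDF a r) (by fun_prop)]
  have hrt : 0 < r + t := by linarith
  have h : ∀ x, (gammaPDF a r * fun x => ENNReal.ofReal (Real.exp (-(t * x)))) x =
      ENNReal.ofReal ((1 + t / r) ^ (-a)) * gammaPDF a (r + t) x := by
    intro x
    simp only [Pi.mul_apply, gammaPDF]
    rw [← ENNReal.ofReal_mul (gammaPDFReal_nonneg ha hr x), ← ENNReal.ofReal_mul (by positivity)]
    congr 1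
    unfold gammaPDFReal
    split_ifs with hx
    · have h1 : (1 + t / r) ^ (-a) * (r + t) ^ a = r ^ a := by
        rw [show 1 + t / r = (r + t) / r by field_simp, Real.rpow_neg (by positivity),
          Real.div_rpow hrt.le hr.le]
        field_simp
      have h2 : Real.exp (-((r + t) * x)) = Real.exp (-(r * x)) * Real.exp (-(t * x)) := by
        rw [← Real.exp_add]; congr 1; ring
      rw [h2, ← h1]
      ring
    · simp
  simp_rw [h]
  rw [lintegral_const_mul _ (measurable_gammaPDF a (r + t)),
    lintegral_gammaPDF_eq_one ha hrt, mul_one]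

/-- Size biasing: `x` times the density of shape `a` is `a / r` times the density of shape `a + 1`.
-/
theorem lintegral_id_gammaMeasure {a r : ℝ} (ha : 0 < a) (hr : 0 < r) :
    ∫⁻ x, ENNReal.ofReal x ∂gammaMeasure a r = ENNReal.ofReal (a / r) := by
  rw [gammaMeasure, lintegral_withDensity_eq_lintegral_mul _
    (measurable_gammaPDF a r) (by fun_prop)]
  have h : ∀ᵐ x : ℝ, (gammaPDF a r * fun x => ENNReal.ofReal x) x =
      ENNReal.ofReal (a / r) * gammaPDF (a + 1) r x := by
    filter_upwards [Measure.ae_ne volume (0 : ℝ)] with x hx0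
    simp only [Pi.mul_apply, gammaPDF]
    rw [← ENNReal.ofReal_mul (gammaPDFReal_nonneg ha hr x), ← ENNReal.ofReal_mul (by positivity)]
    congr 1
    unfold gammaPDFReal
    split_ifs with hx
    · have hx1 : 0 < x := lt_of_le_of_ne hx hx0.symm
      rw [Real.Gamma_add_one ha.ne', Real.rpow_add_one hr.ne', add_sub_cancel_right,
        Real.rpow_sub_one hx0]
      have := (Real.Gamma_pos_of_pos ha).ne'
      field_simp
    · simp
  rw [lintegral_congr_ae h,
    lintegral_const_mul _ (measurable_gammaPDF (a + 1) r),
    lintegral_gammaPDF_eq_one (by linarith) hr, mul_one]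

/-! ### The laws of gains, devices and clusters. -/

theorem LinkType.sum_univ {M : Type*} [AddCommMonoid M] (f : LinkType → M) :
    ∑ z, f z = f .los + f .nlos :=
  Finset.sum_pair (by decide)

theorem isProbabilityMeasure_unitInterval :
    IsProbabilityMeasure ((volume : Measure ℝ).restrict (Set.Icc 0 1)) :=
  ⟨by simp⟩

namespace Params

variable {p : Params}

@[fun_prop]
theorem measurable_losProb (p : Params) : Measurable p.losProb := by
  unfold losProb
  have := Real.continuous_arctan.measurable
  fun_prop

theorem measurable_linkProb (p : Params) (z : LinkType) : Measurable (p.linkProb z) := by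
  cases z
  · exact p.measurable_losProb
  · exact measurable_const.sub p.measurable_losProb

@[fun_prop]
theorem measurable_pathLoss (p : Params) (z : LinkType) : Measurable (p.pathLoss z) := by
  unfold pathLoss
  fun_prop

theorem pathLoss_nonneg (p : Params) (z : LinkType) (g : ℝ) : 0 ≤ p.pathLoss z g :=
  Real.rpow_nonneg (by positivity) _

@[fun_prop]
theorem measurable_linkFactor (p : Params) (z : LinkType) (s : ℝ) :
    Measurable (p.linkFactor z s) := by
  unfold linkFactor
  fun_prop

namespace Admissible

theorem losProb_mem (hp : p.Admissible) (r : ℝ) : p.losProb r ∈ Set.Icc (0 : ℝ) 1 := by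
  have h1 : 0 ≤ p.a * Real.exp (-p.b * (180 / Real.pi * Real.arctan (p.h / r) - p.a)) :=
    mul_nonneg hp.a_pos.le (Real.exp_pos _).le
  unfold losProb
  exact ⟨by positivity, (div_le_one (by positivity)).2 (by linarith)⟩

theorem linkProb_mem (hp : p.Admissible) (z : LinkType) (r : ℝ) :
    p.linkProb z r ∈ Set.Icc (0 : ℝ) 1 := by
  have := hp.losProb_mem r
  cases z
  · exact this
  · exact ⟨sub_nonneg.2 this.2, sub_le_self _ this.1⟩

theorem gain_nonneg (hp : p.Admissible) (i : Fin 4) : 0 ≤ p.gain i := by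
  have := hp.mainU_nonneg
  have := hp.sideU_nonneg
  have := hp.mainD_nonneg
  have := hp.sideD_nonneg
  fin_cases i <;> simp [gain] <;> positivity

theorem gainProb_nonneg (hp : p.Admissible) (i : Fin 4) : 0 ≤ p.gainProb i := by
  have h2 : 0 < 2 * Real.pi := by positivity
  have hu : 0 ≤ p.thetaU / (2 * Real.pi) := div_nonneg hp.thetaU_mem.1 h2.le
  have hu' : 0 ≤ 1 - p.thetaU / (2 * Real.pi) :=
    sub_nonneg.2 ((div_le_one h2).2 hp.thetaU_mem.2)
  have hd : 0 ≤ p.thetaD / (2 * Real.pi) := div_nonneg hp.thetaD_mem.1 h2.le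
  have hd' : 0 ≤ 1 - p.thetaD / (2 * Real.pi) :=
    sub_nonneg.2 ((div_le_one h2).2 hp.thetaD_mem.2)
  fin_cases i
  · exact mul_nonneg hu hd
  · exact mul_nonneg hu hd'
  · exact mul_nonneg hu' hd
  · exact mul_nonneg hu' hd'

theorem linkFactor_mem (hp : p.Admissible) (z : LinkType) {s : ℝ} (hs : 0 ≤ s) (g : ℝ) :
    p.linkFactor z s g ∈ Set.Icc (0 : ℝ) 1 := by
  have hb : ∀ i, 0 ≤ s * p.Pd * p.gain i * p.pathLoss z g / p.m z := fun i =>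
    div_nonneg (mul_nonneg (mul_nonneg (mul_nonneg hs hp.Pd_pos.le) (hp.gain_nonneg i))
      (p.pathLoss_nonneg z g)) (hp.m_pos z).le
  have hsum : ∑ i, p.gainProb i = 1 := by
    simp [Fin.sum_univ_four, gainProb]
    ring
  constructor
  · exact Finset.sum_nonneg fun i _ => mul_nonneg (hp.gainProb_nonneg i)
      (Real.rpow_nonneg (by linarith [hb i]) _)
  · rw [← hsum]
    refine Finset.sum_le_sum fun i _ => mul_le_of_le_one_right (hp.gainProb_nonneg i) ?_
    exact Real.rpow_le_one_of_one_le_of_nonpos (by linarith [hb i]) (by linarith [hp.m_pos z])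

/-- The exponent exceeds the dimension 2, which gives decay at infinity, and `h > 0` removes the
singularity at the origin. -/
theorem lintegral_pathLoss_lt_top (hp : p.Admissible) (z : LinkType) :
    ∫⁻ x : Plane, ENNReal.ofReal (p.pathLoss z ‖x‖) < ∞ := by
  have hint : Integrable (fun x : Plane => (1 + ‖x‖ ^ 2) ^ (-(p.α z) / 2)) :=
    integrable_rpow_neg_one_add_norm_sq (by simpa using hp.two_lt_α z)
  -- Chosen so that `c * (1 + g ^ 2) ≤ g ^ 2 + h ^ 2` for all `g`.
  set c := min 1 (p.h ^ 2) with hc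
  have hc0 : 0 < c := lt_min one_pos (pow_pos hp.h_pos 2)
  refine lt_of_le_of_lt (lintegral_mono fun x => ENNReal.ofReal_le_ofReal ?_)
    (hint.const_mul (c ^ (-(p.α z) / 2))).lintegral_lt_top
  rw [← Real.mul_rpow hc0.le (by positivity)]
  refine Real.rpow_le_rpow_of_nonpos (by positivity) ?_ (by linarith [hp.two_lt_α z])
  have h1 : c ≤ 1 := min_le_left _ _
  have h2 : c ≤ p.h ^ 2 := min_le_right _ _
  nlinarith [sq_nonneg ‖x‖]

theorem isProbabilityMeasure_gainLaw (hp : p.Admissible) : IsProbabilityMeasure p.gainLaw := by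
  constructor
  simp only [gainLaw, Measure.coe_finsetSum, Finset.sum_apply, Measure.smul_apply,
    measure_univ, smul_eq_mul, mul_one]
  rw [← ENNReal.ofReal_sum_of_nonneg fun i _ => hp.gainProb_nonneg i, ENNReal.ofReal_eq_one]
  simp [Fin.sum_univ_four, gainProb]
  ring

theorem isProbabilityMeasure_gamma (hp : p.Admissible) (z : LinkType) :
    IsProbabilityMeasure (gammaMeasure (p.m z) (p.m z)) :=
  isProbabilityMeasure_gammaMeasure (hp.m_pos z) (hp.m_pos z)

theorem isProbabilityMeasure_disc (hp : p.Admissible) :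
    IsProbabilityMeasure (cond (volume : Measure Plane) (Metric.closedBall 0 p.R)) :=
  cond_isProbabilityMeasure_of_finite
    (Metric.measure_closedBall_pos _ _ hp.R_pos).ne' measure_closedBall_lt_top.ne

theorem isProbabilityMeasure_deviceLaw (hp : p.Admissible) : IsProbabilityMeasure p.deviceLaw := by
  have := hp.isProbabilityMeasure_gainLaw
  have := hp.isProbabilityMeasure_gamma
  have := hp.isProbabilityMeasure_disc
  unfold deviceLaw
  infer_instance

theorem isProbabilityMeasure_schedule (hp : p.Admissible) :
    IsProbabilityMeasure (uniformOn {f : Fin p.M → Fin p.N | Function.Injective f}) :=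
  isProbabilityMeasure_uniformOn (Set.toFinite _)
    ⟨Fin.castLE hp.M_le_N, Fin.castLE_injective hp.M_le_N⟩

theorem isProbabilityMeasure_clusterLaw (hp : p.Admissible) :
    IsProbabilityMeasure p.clusterLaw := by
  have := hp.isProbabilityMeasure_deviceLaw
  have := hp.isProbabilityMeasure_schedule
  have := isProbabilityMeasure_unitInterval
  unfold clusterLaw
  infer_instance

theorem lintegral_deviceLaw (hp : p.Admissible) (z : LinkType) {f : Plane → ℝ → ℝ → ℝ≥0∞}
    (hf : Measurable fun q : Plane × ℝ × ℝ => f q.1 q.2.1 q.2.2) :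
    ∫⁻ d, f d.1 d.2.1 (d.2.2 z) ∂p.deviceLaw =
      ∫⁻ y, ∑ i, ENNReal.ofReal (p.gainProb i) *
        ∫⁻ h, f y (p.gain i) h ∂gammaMeasure (p.m z) (p.m z)
          ∂(cond (volume : Measure Plane) (Metric.closedBall 0 p.R)) := by
  have := hp.isProbabilityMeasure_gainLaw
  have := hp.isProbabilityMeasure_gamma
  have := hp.isProbabilityMeasure_disc
  have hm : Measurable fun d : DeviceMark => f d.1 d.2.1 (d.2.2 z) :=
    hf.comp (by fun_prop : Measurable fun d : DeviceMark => (d.1, d.2.1, d.2.2 z))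
  rw [deviceLaw, lintegral_prod _ hm.aemeasurable]
  congr with y
  have hy : Measurable fun d : ℝ × (LinkType → ℝ) => f y d.1 (d.2 z) :=
    hm.comp measurable_prodMk_left
  rw [lintegral_prod _ hy.aemeasurable, gainLaw, lintegral_finsetSum_measure]
  refine Finset.sum_congr rfl fun i _ => ?_
  have hi : Measurable fun h : ℝ => f y (p.gain i) h :=
    hf.comp (by fun_prop : Measurable fun h : ℝ => (y, p.gain i, h))
  rw [lintegral_smul_measure, lintegral_dirac' _ hy.lintegral_prod_right', smul_eq_mul,
    ← (measurePreserving_eval (fun z => gammaMeasure (p.m z) (p.m z)) z).lintegral_comp hi]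

theorem ae_deviceLaw_nonneg (hp : p.Admissible) :
    ∀ᵐ d ∂p.deviceLaw, 0 ≤ d.2.1 ∧ ∀ z, 0 ≤ d.2.2 z := by
  have := hp.isProbabilityMeasure_gainLaw
  have := hp.isProbabilityMeasure_gamma
  have := hp.isProbabilityMeasure_disc
  have hG : ∀ᵐ g ∂p.gainLaw, 0 ≤ g := by
    rw [gainLaw, ae_iff]
    simp [hp.gain_nonneg]
  have hH : ∀ᵐ h ∂(Measure.pi fun z => gammaMeasure (p.m z) (p.m z)), ∀ z, 0 ≤ h z :=
    ae_all_iff.2 fun z => (measurePreserving_eval (fun z => gammaMeasure (p.m z) (p.m z))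
      z).quasiMeasurePreserving.ae (ae_nonneg_gammaMeasure _ _)
  refine Measure.quasiMeasurePreserving_snd.ae
    (p := fun d : ℝ × (LinkType → ℝ) => 0 ≤ d.1 ∧ ∀ z, 0 ≤ d.2 z) ?_
  filter_upwards [Measure.quasiMeasurePreserving_fst.ae hG,
    Measure.quasiMeasurePreserving_snd.ae hH] with d h1 h2 using ⟨h1, h2⟩

/-- For each fixed schedule `f` the device `f c` is one coordinate of an i.i.d. family, so its law
is `deviceLaw`; averaging over schedules changes nothing. -/
theorem measurePreserving_activeDevice (hp : p.Admissible) (c : Fin p.M) :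
    MeasurePreserving (fun t : p.ClusterMark => (t.1, t.2.2 (t.2.1 c))) p.clusterLaw
      (((volume : Measure ℝ).restrict (Set.Icc 0 1)).prod p.deviceLaw) := by
  have := hp.isProbabilityMeasure_deviceLaw
  have := hp.isProbabilityMeasure_schedule
  have hm : Measurable fun t : (Fin p.M → Fin p.N) × (Fin p.N → DeviceMark) => t.2 (t.1 c) :=
    measurable_from_prod_countable_right fun f => measurable_pi_apply (f c)
  refine (MeasurePreserving.id _).prod (f := id) ⟨hm, ?_⟩
  ext B hB
  rw [Measure.map_apply hm hB, Measure.prod_apply (hm hB)]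
  have : ∀ f : Fin p.M → Fin p.N, (Measure.pi fun _ : Fin p.N => p.deviceLaw)
      (Prod.mk f ⁻¹' ((fun t : (Fin p.M → Fin p.N) × (Fin p.N → DeviceMark) =>
        t.2 (t.1 c)) ⁻¹' B)) = p.deviceLaw B := fun f =>
    (measurePreserving_eval (fun _ : Fin p.N => p.deviceLaw) (f c)).measure_preimage
      hB.nullMeasurableSet
  simp_rw [this]
  simp

/-- Averaging over the mark of a cluster: the link state has probability `P_z`, and the active
device has the law of a device. -/
theorem lintegral_clusterLaw (hp : p.Admissible) (c : Fin p.M) {A B : DeviceMark → ℝ≥0∞}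
    (hA : Measurable A) (hB : Measurable B) {r : ℝ} (hr : r ∈ Set.Icc (0 : ℝ) 1) :
    ∫⁻ t : p.ClusterMark, (if t.1 ≤ r then A (t.2.2 (t.2.1 c)) else B (t.2.2 (t.2.1 c)))
        ∂p.clusterLaw =
      ENNReal.ofReal r * ∫⁻ d, A d ∂p.deviceLaw +
        ENNReal.ofReal (1 - r) * ∫⁻ d, B d ∂p.deviceLaw := by
  have := hp.isProbabilityMeasure_deviceLaw
  have hm : Measurable fun t : ℝ × DeviceMark => if t.1 ≤ r then A t.2 else B t.2 :=
    Measurable.ite (measurable_fst measurableSet_Iic) (hA.comp measurable_snd)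
      (hB.comp measurable_snd)
  have h1 := (hp.measurePreserving_activeDevice c).lintegral_comp hm
  simp only at h1
  rw [h1, lintegral_prod _ hm.aemeasurable]
  have h2 : ∀ u : ℝ, ∫⁻ d, (if u ≤ r then A d else B d) ∂p.deviceLaw =
      (Set.Iic r).indicator (fun _ => ∫⁻ d, A d ∂p.deviceLaw) u +
        (Set.Ioi r).indicator (fun _ => ∫⁻ d, B d ∂p.deviceLaw) u := by
    intro u
    by_cases hu : u ≤ r
    · simp [hu]
    · simp [hu, not_le.1 hu]
  simp_rw [h2]
  rw [lintegral_add_left (measurable_const.indicator measurableSet_Iic),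
    lintegral_indicator_const measurableSet_Iic, lintegral_indicator_const measurableSet_Ioi,
    Measure.restrict_apply measurableSet_Iic, Measure.restrict_apply measurableSet_Ioi]
  have e1 : Set.Iic r ∩ Set.Icc 0 1 = Set.Icc 0 r := by
    ext u; simp only [Set.mem_inter_iff, Set.mem_Iic, Set.mem_Icc]
    constructor
    · rintro ⟨h, h', _⟩; exact ⟨h', h⟩
    · rintro ⟨h', h⟩; exact ⟨h, h', h.trans hr.2⟩
  have e2 : Set.Ioi r ∩ Set.Icc 0 1 = Set.Ioc r 1 := by
    ext u; simp only [Set.mem_inter_iff, Set.mem_Ioi, Set.mem_Icc, Set.mem_Ioc]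
    constructor
    · rintro ⟨h, _, h'⟩; exact ⟨h, h'⟩
    · rintro ⟨h, h'⟩; exact ⟨h, hr.1.trans h.le, h'⟩
  rw [e1, e2, Real.volume_Icc, Real.volume_Ioc, sub_zero, mul_comm, mul_comm (ENNReal.ofReal (1 - r))]

end Admissible

end Params

/-! ### The power received from a single cluster. -/

namespace Params

/-- The power received from a device of a cluster with UAV at `x` when the link is in state `z`. -/
noncomputable def devicePower (p : Params) (z : LinkType) (x : Plane) (d : DeviceMark) : ℝ :=
  p.Pd * d.2.1 * d.2.2 z * p.pathLoss z ‖x + d.1‖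

/-- The power received on resource block `c` from a cluster with UAV at `x` and mark `t`, truncated
at zero so that it is nonnegative everywhere and not just almost everywhere. -/
noncomputable def clusterPower (p : Params) (c : Fin p.M) (x : Plane) (t : p.ClusterMark) : ℝ :=
  if t.1 ≤ p.losProb ‖x‖ then max (p.devicePower .los x (t.2.2 (t.2.1 c))) 0
  else max (p.devicePower .nlos x (t.2.2 (t.2.1 c))) 0

/-- The average of `linkFactor` over the position of a device of a cluster whose UAV is at distance
`q`; there is one formula for all `q > 0` because `Real.arccos` is constant outside `[-1, 1]`. -/
noncomputable def avgFactor (p : Params) (z : LinkType) (s q : ℝ) : ℝ :=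
  ∫ g in Set.Ioi (0 : ℝ), p.linkFactor z s g *
    (2 * g / (Real.pi * p.R ^ 2) * Real.arccos ((g ^ 2 + q ^ 2 - p.R ^ 2) / (2 * g * q)))

variable {p : Params}

theorem measurable_devicePower (p : Params) (z : LinkType) :
    Measurable (Function.uncurry (p.devicePower z)) := by
  unfold devicePower
  have : Measurable fun q : Plane × DeviceMark => p.pathLoss z ‖q.1 + q.2.1‖ := by fun_prop
  have : Measurable fun q : Plane × DeviceMark => p.Pd * q.2.2.1 * q.2.2.2 z := by fun_prop
  simp only [Function.uncurry_def]
  fun_prop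

theorem measurable_clusterPower (p : Params) (c : Fin p.M) :
    Measurable (Function.uncurry (p.clusterPower c)) := by
  have hm : Measurable fun t : (Fin p.M → Fin p.N) × (Fin p.N → DeviceMark) => t.2 (t.1 c) :=
    measurable_from_prod_countable_right fun f => measurable_pi_apply (f c)
  have hd : ∀ z, Measurable fun q : Plane × p.ClusterMark =>
      max (p.devicePower z q.1 (q.2.2.2 (q.2.2.1 c))) 0 := fun z =>
    ((p.measurable_devicePower z).comp (measurable_fst.prodMk
      (hm.comp (measurable_snd.comp measurable_snd)))).max measurable_const
  exact Measurable.ite (measurableSet_le (by fun_prop) (by fun_prop)) (hd _) (hd _)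

theorem clusterPower_nonneg (p : Params) (c : Fin p.M) (x : Plane) (t : p.ClusterMark) :
    0 ≤ p.clusterPower c x t := by
  unfold clusterPower
  split_ifs <;> exact le_max_right _ _

theorem measurable_avgFactor (p : Params) (z : LinkType) (s : ℝ) :
    Measurable (p.avgFactor z s) := by
  have hm : Measurable (Function.uncurry fun q g : ℝ => p.linkFactor z s g *
      (2 * g / (Real.pi * p.R ^ 2) *
        Real.arccos ((g ^ 2 + q ^ 2 - p.R ^ 2) / (2 * g * q)))) := by
    have := Real.continuous_arccos.measurable
    simp only [Function.uncurry_def]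
    fun_prop
  exact (hm.stronglyMeasurable.integral_prod_right (ν := volume.restrict (Set.Ioi 0))).measurable

namespace Admissible

/-- For a fixed displacement and gain, the fading average is the gamma Laplace transform; the sum
over gains is then `linkFactor`. The truncation is invisible since gamma variables are almost surely
nonnegative. -/
theorem lintegral_exp_neg_devicePower (hp : p.Admissible) (z : LinkType) {s : ℝ} (hs : 0 ≤ s)
    (x : Plane) :
    ∫⁻ d, ENNReal.ofReal (Real.exp (-(s * max (p.devicePower z x d) 0))) ∂p.deviceLaw =
      ∫⁻ y, ENNReal.ofReal (p.linkFactor z s ‖x + y‖)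
        ∂(cond (volume : Measure Plane) (Metric.closedBall 0 p.R)) := by
  have hm : Measurable fun q : Plane × ℝ × ℝ => ENNReal.ofReal
      (Real.exp (-(s * max (p.Pd * q.2.1 * q.2.2 * p.pathLoss z ‖x + q.1‖) 0))) := by
    fun_prop
  refine (hp.lintegral_deviceLaw z (f := fun y G h => ENNReal.ofReal
    (Real.exp (-(s * max (p.Pd * G * h * p.pathLoss z ‖x + y‖) 0)))) hm).trans ?_
  congr with y
  unfold linkFactor
  have hb : ∀ i, 0 ≤ s * p.Pd * p.gain i * p.pathLoss z ‖x + y‖ := fun i =>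
    mul_nonneg (mul_nonneg (mul_nonneg hs hp.Pd_pos.le) (hp.gain_nonneg i)) (p.pathLoss_nonneg z _)
  rw [ENNReal.ofReal_sum_of_nonneg fun i _ => mul_nonneg (hp.gainProb_nonneg i)
    (Real.rpow_nonneg (add_nonneg zero_le_one (div_nonneg (hb i) (hp.m_pos z).le)) _)]
  refine Finset.sum_congr rfl fun i _ => ?_
  rw [ENNReal.ofReal_mul (hp.gainProb_nonneg i),
    ← lintegral_exp_neg_mul_gammaMeasure (hp.m_pos z) (hp.m_pos z) (hb i)]
  congr 1
  refine lintegral_congr_ae ?_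
  filter_upwards [ae_nonneg_gammaMeasure (p.m z) (p.m z)] with h hh
  rw [max_eq_left (mul_nonneg (mul_nonneg (mul_nonneg hp.Pd_pos.le (hp.gain_nonneg i)) hh)
    (p.pathLoss_nonneg z _))]
  congr 3
  ring

/-- By Tonelli the UAV position is integrated first. Translation invariance absorbs the displacement
of the device, leaving the total path loss times the mean of gain and fading. -/
theorem lintegral_devicePower_lt_top (hp : p.Admissible) (z : LinkType) :
    ∫⁻ x, ∫⁻ d, ENNReal.ofReal (max (p.devicePower z x d) 0) ∂p.deviceLaw < ∞ := by
  have := hp.isProbabilityMeasure_deviceLaw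
  have := hp.isProbabilityMeasure_disc
  have hm : Measurable (Function.uncurry fun x d =>
      ENNReal.ofReal (max (p.devicePower z x d) 0)) :=
    ENNReal.measurable_ofReal.comp ((p.measurable_devicePower z).max measurable_const)
  rw [lintegral_lintegral_swap hm.aemeasurable]
  have h1 : ∀ d : DeviceMark, ∫⁻ x, ENNReal.ofReal (max (p.devicePower z x d) 0) =
      ENNReal.ofReal (p.Pd * d.2.1 * d.2.2 z) * ∫⁻ x : Plane, ENNReal.ofReal (p.pathLoss z ‖x‖) := by
    intro d
    rw [← lintegral_add_right_eq_self (fun x : Plane => ENNReal.ofReal (p.pathLoss z ‖x‖)) d.1,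
      ← lintegral_const_mul _ (by fun_prop)]
    congr with x
    rw [← ENNReal.ofReal_mul' (p.pathLoss_nonneg z _), ENNReal.ofReal_max, ENNReal.ofReal_zero,
      max_eq_left zero_le]
    rfl
  simp_rw [h1]
  rw [lintegral_mul_const _ (by fun_prop)]
  refine ENNReal.mul_lt_top ?_ (hp.lintegral_pathLoss_lt_top z)
  refine (hp.lintegral_deviceLaw z (f := fun _ G h => ENNReal.ofReal (p.Pd * G * h))
    (by fun_prop)).trans_lt ?_
  simp only [lintegral_const, measure_univ, mul_one]
  refine ENNReal.sum_lt_top.2 fun i _ => ENNReal.mul_lt_top ENNReal.ofReal_lt_top ?_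
  simp_rw [ENNReal.ofReal_mul (mul_nonneg hp.Pd_pos.le (hp.gain_nonneg i))]
  rw [lintegral_const_mul _ (by fun_prop), lintegral_id_gammaMeasure (hp.m_pos z) (hp.m_pos z)]
  exact ENNReal.mul_lt_top ENNReal.ofReal_lt_top ENNReal.ofReal_lt_top

theorem lintegral_clusterPower_lt_top (hp : p.Admissible) (c : Fin p.M) :
    ∫⁻ x, ∫⁻ t, ENNReal.ofReal (p.clusterPower c x t) ∂p.clusterLaw < ∞ := by
  have := hp.isProbabilityMeasure_deviceLaw
  have hm : ∀ z, Measurable (Function.uncurry fun x d =>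
      ENNReal.ofReal (max (p.devicePower z x d) 0)) := fun z =>
    ENNReal.measurable_ofReal.comp ((p.measurable_devicePower z).max measurable_const)
  have hle : ∀ x, ∫⁻ t, ENNReal.ofReal (p.clusterPower c x t) ∂p.clusterLaw ≤
      ∫⁻ d, ENNReal.ofReal (max (p.devicePower .los x d) 0) ∂p.deviceLaw +
        ∫⁻ d, ENNReal.ofReal (max (p.devicePower .nlos x d) 0) ∂p.deviceLaw := by
    intro x
    have hr := hp.losProb_mem ‖x‖
    simp_rw [clusterPower, apply_ite ENNReal.ofReal]
    rw [hp.lintegral_clusterLaw c (A := fun d => ENNReal.ofReal (max (p.devicePower .los x d) 0))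
      (B := fun d => ENNReal.ofReal (max (p.devicePower .nlos x d) 0))
      (hm _).of_uncurry_left (hm _).of_uncurry_left hr]
    exact add_le_add (mul_le_of_le_one_left' (ENNReal.ofReal_le_one.2 hr.2))
      (mul_le_of_le_one_left' (ENNReal.ofReal_le_one.2 (by linarith [hr.1])))
  refine (lintegral_mono hle).trans_lt ?_
  have hl : Measurable fun x =>
      ∫⁻ d, ENNReal.ofReal (max (p.devicePower .los x d) 0) ∂p.deviceLaw :=
    (hm .los).lintegral_prod_right'
  rw [lintegral_add_left hl]
  exact ENNReal.add_lt_top.2 ⟨hp.lintegral_devicePower_lt_top _, hp.lintegral_devicePower_lt_top _⟩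

theorem lintegral_linkFactor_disc (hp : p.Admissible) (z : LinkType) {s : ℝ} (hs : 0 ≤ s)
    {x : Plane} (hx : x ≠ 0) :
    ∫⁻ y, ENNReal.ofReal (p.linkFactor z s ‖x + y‖)
        ∂(cond (volume : Measure Plane) (Metric.closedBall 0 p.R)) =
      ENNReal.ofReal (p.avgFactor z s ‖x‖) := by
  have := hp.isProbabilityMeasure_disc
  have hR := hp.R_pos
  have hle : ∫⁻ y, ENNReal.ofReal (p.linkFactor z s ‖x + y‖)
      ∂(cond (volume : Measure Plane) (Metric.closedBall 0 p.R)) ≤ 1 :=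
    (lintegral_mono fun y => ENNReal.ofReal_le_one.2 (hp.linkFactor_mem z hs _).2).trans_eq (by simp)
  have h0 : ∀ g ∈ Set.Ioi (0 : ℝ), 0 ≤ p.linkFactor z s g *
      (2 * g / (Real.pi * p.R ^ 2) *
        Real.arccos ((g ^ 2 + ‖x‖ ^ 2 - p.R ^ 2) / (2 * g * ‖x‖))) := fun g hg => by
    have : 0 < g := hg
    exact mul_nonneg (hp.linkFactor_mem z hs _).1
      (mul_nonneg (by positivity) (Real.arccos_nonneg _))
  have hm : Measurable fun g => p.linkFactor z s g * (2 * g / (Real.pi * p.R ^ 2) *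
      Real.arccos ((g ^ 2 + ‖x‖ ^ 2 - p.R ^ 2) / (2 * g * ‖x‖))) := by
    have := Real.continuous_arccos.measurable
    fun_prop
  rw [avgFactor, integral_eq_lintegral_of_nonneg_ae
    ((ae_restrict_iff' measurableSet_Ioi).2 (.of_forall h0)) hm.aestronglyMeasurable]
  have key : ∫⁻ y, ENNReal.ofReal (p.linkFactor z s ‖x + y‖)
        ∂(cond (volume : Measure Plane) (Metric.closedBall 0 p.R)) =
      ∫⁻ g in Set.Ioi (0 : ℝ), ENNReal.ofReal (p.linkFactor z s g * (2 * g / (Real.pi * p.R ^ 2) *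
        Real.arccos ((g ^ 2 + ‖x‖ ^ 2 - p.R ^ 2) / (2 * g * ‖x‖)))) := by
    have hk : Measurable fun g => ENNReal.ofReal (p.linkFactor z s g) := by fun_prop
    have hm' : Measurable fun g => ENNReal.ofReal (p.linkFactor z s g) *
        ENNReal.ofReal (g * (2 * Real.arccos ((g ^ 2 + ‖x‖ ^ 2 - p.R ^ 2) / (2 * g * ‖x‖)))) := by
      have := Real.continuous_arccos.measurable
      fun_prop
    rw [ProbabilityTheory.cond, lintegral_smul_measure,
      lintegral_closedBall_norm_add hk hR.le hx, smul_eq_mul, ← lintegral_const_mul _ hm',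
      EuclideanSpace.volume_closedBall_fin_two, ← ENNReal.ofReal_pow hR.le,
      ← ENNReal.ofReal_mul (by positivity), ← ENNReal.ofReal_inv_of_pos (by positivity)]
    refine setLIntegral_congr_fun measurableSet_Ioi fun g hg => ?_
    have hg : 0 < g := hg
    rw [← ENNReal.ofReal_mul (hp.linkFactor_mem z hs _).1, ← ENNReal.ofReal_mul (by positivity)]
    congr 1
    field_simp
  rw [← key, ENNReal.ofReal_toReal (ne_top_of_le_ne_top ENNReal.one_ne_top hle)]

/-- The upper bound is not visible from the radial formula; it holds because `avgFactor` is an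
average of `linkFactor` over the disc. -/
theorem avgFactor_mem (hp : p.Admissible) (z : LinkType) {s : ℝ} (hs : 0 ≤ s)
    {x : Plane} (hx : x ≠ 0) : p.avgFactor z s ‖x‖ ∈ Set.Icc (0 : ℝ) 1 := by
  have := hp.isProbabilityMeasure_disc
  have hR := hp.R_pos
  constructor
  · refine setIntegral_nonneg measurableSet_Ioi fun g hg => ?_
    have : 0 < g := hg
    exact mul_nonneg (hp.linkFactor_mem z hs _).1
      (mul_nonneg (by positivity) (Real.arccos_nonneg _))
  · rw [← ENNReal.ofReal_le_one, ← hp.lintegral_linkFactor_disc z hs hx]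
    exact (lintegral_mono fun y =>
      ENNReal.ofReal_le_one.2 (hp.linkFactor_mem z hs _).2).trans_eq (by simp)

/-- The Laplace transform of the power received from a cluster with UAV at `x`. -/
theorem integral_exp_neg_clusterPower (hp : p.Admissible) (c : Fin p.M) {s : ℝ} (hs : 0 ≤ s)
    {x : Plane} (hx : x ≠ 0) :
    ∫ t, Real.exp (-(s * p.clusterPower c x t)) ∂p.clusterLaw =
      ∑ z, p.linkProb z ‖x‖ * p.avgFactor z s ‖x‖ := by
  have hr := hp.losProb_mem ‖x‖
  have hm : ∀ z, Measurable fun d =>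
      ENNReal.ofReal (Real.exp (-(s * max (p.devicePower z x d) 0))) := fun z => by
    have : Measurable (p.devicePower z x) := (p.measurable_devicePower z).of_uncurry_left
    fun_prop
  have hc : Measurable (p.clusterPower c x) := (p.measurable_clusterPower c).of_uncurry_left
  have h1 : ∫⁻ t, ENNReal.ofReal (Real.exp (-(s * p.clusterPower c x t))) ∂p.clusterLaw =
      ENNReal.ofReal (∑ z, p.linkProb z ‖x‖ * p.avgFactor z s ‖x‖) := by
    have e : ∀ t : p.ClusterMark, ENNReal.ofReal (Real.exp (-(s * p.clusterPower c x t))) =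
        if t.1 ≤ p.losProb ‖x‖ then ENNReal.ofReal (Real.exp
          (-(s * max (p.devicePower .los x (t.2.2 (t.2.1 c))) 0)))
        else ENNReal.ofReal (Real.exp
          (-(s * max (p.devicePower .nlos x (t.2.2 (t.2.1 c))) 0))) := by
      intro t
      unfold clusterPower
      split_ifs <;> rfl
    simp_rw [e]
    rw [hp.lintegral_clusterLaw c (hm .los) (hm .nlos) hr]
    rw [hp.lintegral_exp_neg_devicePower _ hs, hp.lintegral_exp_neg_devicePower _ hs,
      hp.lintegral_linkFactor_disc _ hs hx, hp.lintegral_linkFactor_disc _ hs hx,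
      ← ENNReal.ofReal_mul hr.1, ← ENNReal.ofReal_mul (sub_nonneg.2 hr.2), LinkType.sum_univ,
      ← ENNReal.ofReal_add (mul_nonneg hr.1 (hp.avgFactor_mem _ hs hx).1)
        (mul_nonneg (sub_nonneg.2 hr.2) (hp.avgFactor_mem _ hs hx).1)]
    rfl
  rw [integral_eq_lintegral_of_nonneg_ae (.of_forall fun t => (Real.exp_pos _).le)
    (by fun_prop), h1, ENNReal.toReal_ofReal]
  exact Finset.sum_nonneg fun z _ => mul_nonneg (hp.linkProb_mem z _).1 (hp.avgFactor_mem z hs hx).1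

/-- A circle of radius `g > R + q` misses the disc: `(g - q) ^ 2 ≥ R ^ 2` puts the argument of the
arccosine at 1 or above. -/
theorem avgFactor_eq_add (hp : p.Admissible) (z : LinkType) {s : ℝ} (hs : 0 ≤ s) {q : ℝ}
    (hq : 0 < q) :
    p.avgFactor z s q = (∫ g in (0 : ℝ)..|q - p.R|, p.linkFactor z s g *
      (2 * g / (Real.pi * p.R ^ 2) * Real.arccos ((g ^ 2 + q ^ 2 - p.R ^ 2) / (2 * g * q)))) +
      p.Oe2 z s q := by
  have hR := hp.R_pos
  set w : ℝ → ℝ := fun g => p.linkFactor z s g *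
    (2 * g / (Real.pi * p.R ^ 2) * Real.arccos ((g ^ 2 + q ^ 2 - p.R ^ 2) / (2 * g * q))) with hw
  have hm : Measurable w := by
    have := Real.continuous_arccos.measurable
    fun_prop
  have hint : ∀ a b, IntervalIntegrable w volume a b := by
    intro a b
    refine IntervalIntegrable.mono_fun'
      (g := fun g => 1 * (2 * |g| / (Real.pi * p.R ^ 2) * Real.pi)) ?_ hm.aestronglyMeasurable
      (.of_forall fun g => ?_)
    · exact Continuous.intervalIntegrable (by fun_prop) _ _
    · have h1 := hp.linkFactor_mem z hs g
      simp only [hw]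
      rw [Real.norm_eq_abs, abs_mul, abs_mul, abs_of_nonneg h1.1, abs_div, abs_mul,
        abs_of_nonneg (Real.arccos_nonneg _), abs_of_pos (by norm_num : (0 : ℝ) < 2),
        abs_of_pos (by positivity : 0 < Real.pi * p.R ^ 2)]
      exact mul_le_mul h1.2 (mul_le_mul_of_nonneg_left (Real.arccos_le_pi _) (by positivity))
        (mul_nonneg (by positivity) (Real.arccos_nonneg _)) zero_le_one
  rw [Oe2, intervalIntegral.integral_add_adjacent_intervals (hint _ _) (hint _ _),
    intervalIntegral.integral_of_le (by positivity), avgFactor]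
  refine (setIntegral_eq_of_subset_of_forall_sdiff_eq_zero measurableSet_Ioi
    Set.Ioc_subset_Ioi_self fun g hg => ?_)
  have hg0 : 0 < g := hg.1
  have hg1 : p.R + q < g := by
    by_contra! hle
    exact hg.2 ⟨hg0, hle⟩
  rw [Real.arccos_of_one_le, mul_zero, mul_zero]
  rw [one_le_div (by positivity)]
  nlinarith

theorem avgFactor_eq_Oe2 (hp : p.Admissible) (z : LinkType) {s : ℝ} (hs : 0 ≤ s) {q : ℝ}
    (hq : p.R ≤ q) : p.avgFactor z s q = p.Oe2 z s q := by
  have hR := hp.R_pos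
  have hq0 : 0 < q := hR.trans_le hq
  rw [hp.avgFactor_eq_add z hs hq0, abs_of_nonneg (sub_nonneg.2 hq), add_eq_right,
    intervalIntegral.integral_of_le (sub_nonneg.2 hq)]
  refine setIntegral_eq_zero_of_forall_eq_zero fun g hg => ?_
  have hg0 : 0 < g := hg.1
  have hg1 : g ≤ q - p.R := hg.2
  -- For `g ≤ q - R` the circle stops short of the disc.
  rw [Real.arccos_of_one_le, mul_zero, mul_zero]
  rw [one_le_div (by positivity)]
  nlinarith

theorem avgFactor_eq_Oe1 (hp : p.Admissible) (z : LinkType) {s : ℝ} (hs : 0 ≤ s) {q : ℝ}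
    (hq0 : 0 < q) (hq : q ≤ p.R) : p.avgFactor z s q = p.Oe1 z s q := by
  have hR := hp.R_pos
  rw [hp.avgFactor_eq_add z hs hq0, Oe1, add_comm, Oe2, abs_of_nonpos (sub_nonpos.2 hq), neg_sub,
    add_right_inj, intervalIntegral.integral_of_le (sub_nonneg.2 hq),
    intervalIntegral.integral_of_le (sub_nonneg.2 hq)]
  refine setIntegral_congr_fun measurableSet_Ioc fun g hg => ?_
  have hg0 : 0 < g := hg.1
  have hg1 : g ≤ p.R - q := hg.2
  -- For `g ≤ R - q` the whole circle lies in the disc; the arccosine is π and cancels the π of the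
  -- area.
  rw [Real.arccos_of_le_neg_one]
  · field_simp
  · rw [div_le_iff₀ (by positivity)]
    nlinarith

end Admissible

end Params

/-! ### Integration over the UAV position in polar coordinates. -/

namespace Params

variable {p : Params}

theorem linkProb_los_add_nlos (p : Params) (r : ℝ) :
    p.linkProb .los r + p.linkProb .nlos r = 1 :=
  add_sub_cancel _ _

theorem sigmaFinite_intensity (p : Params) :
    SigmaFinite (ENNReal.ofReal p.lam • (volume : Measure Plane)) :=
  inferInstanceAs (SigmaFinite (p.lam.toNNReal • (volume : Measure Plane)))

namespace Admissible

/-- Because the link probabilities sum to one, the 1 can be distributed over the states. This is the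
source of the product over `z`. -/
theorem one_sub_integral_exp_neg_clusterPower (hp : p.Admissible) (c : Fin p.M) {s : ℝ}
    (hs : 0 ≤ s) {x : Plane} (hx : x ≠ 0) :
    1 - ∫ t, Real.exp (-(s * p.clusterPower c x t)) ∂p.clusterLaw =
      ∑ z, p.linkProb z ‖x‖ * (1 - p.avgFactor z s ‖x‖) := by
  rw [hp.integral_exp_neg_clusterPower c hs hx, LinkType.sum_univ, LinkType.sum_univ]
  linear_combination -p.linkProb_los_add_nlos ‖x‖

theorem lintegral_mul_clusterPower_ne_top (hp : p.Admissible) (c : Fin p.M) {s : ℝ}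
    (hs : 0 ≤ s) :
    ∫⁻ x, ∫⁻ t, ENNReal.ofReal (s * p.clusterPower c x t) ∂p.clusterLaw
      ∂(ENNReal.ofReal p.lam • (volume : Measure Plane)) ≠ ∞ := by
  have := hp.isProbabilityMeasure_clusterLaw
  have hm : Measurable (Function.uncurry fun x t => ENNReal.ofReal (p.clusterPower c x t)) :=
    ENNReal.measurable_ofReal.comp (p.measurable_clusterPower c)
  have hl : Measurable fun x => ∫⁻ t, ENNReal.ofReal (p.clusterPower c x t) ∂p.clusterLaw :=
    hm.lintegral_prod_right'
  have hx : ∀ x, ∫⁻ t, ENNReal.ofReal (s * p.clusterPower c x t) ∂p.clusterLaw =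
      ENNReal.ofReal s * ∫⁻ t, ENNReal.ofReal (p.clusterPower c x t) ∂p.clusterLaw := by
    intro x
    simp_rw [ENNReal.ofReal_mul hs]
    exact lintegral_const_mul _ hm.of_uncurry_left
  simp_rw [hx]
  rw [lintegral_smul_measure, lintegral_const_mul _ hl, smul_eq_mul]
  exact ENNReal.mul_ne_top ENNReal.ofReal_ne_top
    (ENNReal.mul_ne_top ENNReal.ofReal_ne_top (hp.lintegral_clusterPower_lt_top c).ne)

/-- Off the origin, each state's term is nonnegative and hence dominated by the sum over states,
which is the integrable exponent of the Laplace functional. -/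
theorem integrable_radial (hp : p.Admissible) (c : Fin p.M) {s : ℝ} (hs : 0 ≤ s) (z : LinkType) :
    Integrable fun x : Plane => p.linkProb z ‖x‖ * (1 - p.avgFactor z s ‖x‖) := by
  have := hp.isProbabilityMeasure_clusterLaw
  have hI := integrable_one_sub_integral_exp (Λ := ENNReal.ofReal p.lam • (volume : Measure Plane))
    (ν := p.clusterLaw) (f := fun x t => s * p.clusterPower c x t)
    ((p.measurable_clusterPower c).const_mul s)
    (fun x t => mul_nonneg hs (p.clusterPower_nonneg c x t))
    (hp.lintegral_mul_clusterPower_ne_top c hs)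
  rw [integrable_smul_measure (ENNReal.ofReal_pos.2 hp.lam_pos).ne' ENNReal.ofReal_ne_top] at hI
  refine hI.mono (((p.measurable_linkProb z).mul (measurable_const.sub
    (measurable_avgFactor p z s))).comp measurable_norm).aestronglyMeasurable ?_
  filter_upwards [Measure.ae_ne volume (0 : Plane)] with x hx
  rw [hp.one_sub_integral_exp_neg_clusterPower c hs hx]
  have h0 : ∀ z, 0 ≤ p.linkProb z ‖x‖ * (1 - p.avgFactor z s ‖x‖) := fun z =>
    mul_nonneg (hp.linkProb_mem z _).1 (sub_nonneg.2 (hp.avgFactor_mem z hs hx).2)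
  rw [Real.norm_eq_abs, Real.norm_eq_abs, abs_of_nonneg (h0 z),
    abs_of_nonneg (Finset.sum_nonneg fun z _ => h0 z)]
  exact Finset.single_le_sum (f := fun z => p.linkProb z ‖x‖ * (1 - p.avgFactor z s ‖x‖))
    (fun z _ => h0 z) (Finset.mem_univ z)

theorem integrableOn_radial (hp : p.Admissible) (c : Fin p.M) {s : ℝ} (hs : 0 ≤ s)
    (z : LinkType) :
    IntegrableOn (fun q => (1 - p.avgFactor z s q) * q * p.linkProb z q) (Set.Ioi 0) := by
  have h := (integrable_fun_norm_addHaar (volume : Measure Plane)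
    (f := fun q => p.linkProb z q * (1 - p.avgFactor z s q))).1 (hp.integrable_radial c hs z)
  refine h.congr_fun (fun q _ => ?_) measurableSet_Ioi
  simp only [finrank_euclideanSpace_fin, smul_eq_mul]
  norm_num
  ring

theorem integrableOn_Oe1 (hp : p.Admissible) (c : Fin p.M) {s : ℝ} (hs : 0 ≤ s) (z : LinkType) :
    IntegrableOn (fun q => (1 - p.Oe1 z s q) * q * p.linkProb z q) (Set.Ioc 0 p.R) :=
  ((hp.integrableOn_radial c hs z).mono_set Set.Ioc_subset_Ioi_self).congr_fun
    (fun q hq => by simp only [hp.avgFactor_eq_Oe1 z hs hq.1 hq.2]) measurableSet_Ioc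

theorem integrableOn_Oe2 (hp : p.Admissible) (c : Fin p.M) {s : ℝ} (hs : 0 ≤ s) (z : LinkType) :
    IntegrableOn (fun q => (1 - p.Oe2 z s q) * q * p.linkProb z q) (Set.Ioi p.R) :=
  ((hp.integrableOn_radial c hs z).mono_set (Set.Ioi_subset_Ioi hp.R_pos.le)).congr_fun
    (fun q hq => by simp only [hp.avgFactor_eq_Oe2 z hs (le_of_lt hq)]) measurableSet_Ioi

theorem integral_radial (hp : p.Admissible) (c : Fin p.M) {s : ℝ} (hs : 0 ≤ s) (z : LinkType) :
    ∫ x : Plane, p.linkProb z ‖x‖ * (1 - p.avgFactor z s ‖x‖) =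
      2 * Real.pi * ((∫ q in (0 : ℝ)..p.R, (1 - p.Oe1 z s q) * q * p.linkProb z q) +
        ∫ q in Set.Ioi p.R, (1 - p.Oe2 z s q) * q * p.linkProb z q) := by
  -- The factor `2π` arises as the dimension times the area of the unit disc.
  have hball : (volume : Measure Plane).real (Metric.ball 0 1) = Real.pi := by
    simp [measureReal_def, Real.pi_nonneg]
  rw [integral_fun_norm_addHaar (volume : Measure Plane)
    (fun q => p.linkProb z q * (1 - p.avgFactor z s q)), hball, finrank_euclideanSpace_fin]
  have h1 : ∫ q in Set.Ioi (0 : ℝ), q ^ (2 - 1) • (p.linkProb z q * (1 - p.avgFactor z s q)) =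
      ∫ q in Set.Ioi (0 : ℝ), (1 - p.avgFactor z s q) * q * p.linkProb z q := by
    congr with q
    norm_num
    ring
  have hrad := hp.integrableOn_radial c hs z
  rw [h1, ← Set.Ioc_union_Ioi_eq_Ioi hp.R_pos.le,
    setIntegral_union (Set.Ioc_disjoint_Ioi le_rfl) measurableSet_Ioi
      (hrad.mono_set Set.Ioc_subset_Ioi_self) (hrad.mono_set (Set.Ioi_subset_Ioi hp.R_pos.le)),
    intervalIntegral.integral_of_le hp.R_pos.le,
    setIntegral_congr_fun measurableSet_Ioc fun q hq => by
      simp only [hp.avgFactor_eq_Oe1 z hs hq.1 hq.2]; rfl,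
    setIntegral_congr_fun measurableSet_Ioi fun q hq => by
      simp only [hp.avgFactor_eq_Oe2 z hs (le_of_lt hq)]; rfl]
  simp only [nsmul_eq_mul, smul_eq_mul]
  push_cast
  ring

theorem integral_one_sub_exp_neg_clusterPower (hp : p.Admissible) (c : Fin p.M) {s : ℝ}
    (hs : 0 ≤ s) :
    ∫ x, (1 - ∫ t, Real.exp (-(s * p.clusterPower c x t)) ∂p.clusterLaw)
        ∂(ENNReal.ofReal p.lam • (volume : Measure Plane)) =
      ∑ z, 2 * Real.pi * p.lam *
        ((∫ q in (0 : ℝ)..p.R, (1 - p.Oe1 z s q) * q * p.linkProb z q) +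
          ∫ q in Set.Ioi p.R, (1 - p.Oe2 z s q) * q * p.linkProb z q) := by
  rw [integral_smul_measure, ENNReal.toReal_ofReal hp.lam_pos.le, smul_eq_mul]
  have h : (fun x : Plane => 1 - ∫ t, Real.exp (-(s * p.clusterPower c x t)) ∂p.clusterLaw)
      =ᵐ[volume] fun x => ∑ z, p.linkProb z ‖x‖ * (1 - p.avgFactor z s ‖x‖) := by
    filter_upwards [Measure.ae_ne volume (0 : Plane)] with x hx
    exact hp.one_sub_integral_exp_neg_clusterPower c hs hx
  rw [integral_congr_ae h, integral_finsetSum _ fun z _ => hp.integrable_radial c hs z,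
    Finset.mul_sum]
  refine Finset.sum_congr rfl fun z _ => ?_
  rw [hp.integral_radial c hs z]
  ring

end Admissible

end Params

/-! ### From the truncated cluster power to the interference. -/

theorem receivedPower_nonneg {Ω : Type*} {p : Params} {X : ℕ → Ω → Plane} {T : ℕ → Ω → p.ClusterMark}
    (hp : p.Admissible) {c : Fin p.M} {n : ℕ} {ω : Ω}
    (h : 0 ≤ (activeDevice p T c n ω).2.1 ∧ ∀ z, 0 ≤ (activeDevice p T c n ω).2.2 z)
    (z : LinkType) : 0 ≤ receivedPower p X T c z n ω := by
  unfold receivedPower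
  split_ifs
  · exact mul_nonneg (mul_nonneg (mul_nonneg hp.Pd_pos.le h.1) (h.2 z)) (p.pathLoss_nonneg z _)
  · exact le_rfl

/-- Only the term of the actual link state survives, and nonnegative gain and fading make the
truncation in `clusterPower` harmless. -/
theorem sum_receivedPower {Ω : Type*} {p : Params} {X : ℕ → Ω → Plane} {T : ℕ → Ω → p.ClusterMark}
    (hp : p.Admissible) {c : Fin p.M} {n : ℕ} {ω : Ω}
    (h : 0 ≤ (activeDevice p T c n ω).2.1 ∧ ∀ z, 0 ≤ (activeDevice p T c n ω).2.2 z) :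
    ∑ z, receivedPower p X T c z n ω = p.clusterPower c (X n ω) (T n ω) := by
  have h0 : ∀ z, 0 ≤ p.devicePower z (X n ω) (activeDevice p T c n ω) := fun z =>
    mul_nonneg (mul_nonneg (mul_nonneg hp.Pd_pos.le h.1) (h.2 z)) (p.pathLoss_nonneg z _)
  have e : p.clusterPower c (X n ω) (T n ω) = if (T n ω).1 ≤ p.losProb ‖X n ω‖
      then max (p.devicePower .los (X n ω) (activeDevice p T c n ω)) 0
      else max (p.devicePower .nlos (X n ω) (activeDevice p T c n ω)) 0 := rfl
  rw [LinkType.sum_univ, e, max_eq_left (h0 _), max_eq_left (h0 _)]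
  unfold receivedPower linkType
  split_ifs <;> simp_all [Params.devicePower]

variable {Ω : Type*} [MeasurableSpace Ω] {P : Measure Ω} {p : Params} {X : ℕ → Ω → Plane}
  {T : ℕ → Ω → p.ClusterMark}

theorem ae_activeDevice_nonneg (hp : p.Admissible)
    (hT : IsIndependentMarking P p.clusterLaw X T) (c : Fin p.M) :
    ∀ᵐ ω ∂P, ∀ n, 0 ≤ (activeDevice p T c n ω).2.1 ∧ ∀ z, 0 ≤ (activeDevice p T c n ω).2.2 z := by
  have := hp.isProbabilityMeasure_deviceLaw
  have h : ∀ᵐ t ∂p.clusterLaw, 0 ≤ (t.2.2 (t.2.1 c)).2.1 ∧ ∀ z, 0 ≤ (t.2.2 (t.2.1 c)).2.2 z :=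
    (hp.measurePreserving_activeDevice c).quasiMeasurePreserving.ae
      (Measure.quasiMeasurePreserving_snd.ae hp.ae_deviceLaw_nonneg)
  refine ae_all_iff.2 fun n => ?_
  rw [← (hT.law n).map_eq] at h
  exact ae_of_ae_map (hT.law n).aemeasurable h

theorem ae_summable_clusterPower [IsProbabilityMeasure P] (hp : p.Admissible)
    (hnet : IsNetwork p P X T) (c : Fin p.M) :
    ∀ᵐ ω ∂P, Summable fun n => p.clusterPower c (X n ω) (T n ω) := by
  have := hp.isProbabilityMeasure_clusterLaw
  have := p.sigmaFinite_intensity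
  refine ae_summable_marked hnet.parents hnet.clusters (p.measurable_clusterPower c)
    (p.clusterPower_nonneg c) ?_
  simpa only [one_mul] using hp.lintegral_mul_clusterPower_ne_top c zero_le_one

theorem ae_summable_receivedPower [IsProbabilityMeasure P] (hp : p.Admissible)
    (hnet : IsNetwork p P X T) (c : Fin p.M) (z : LinkType) :
    ∀ᵐ ω ∂P, Summable fun n => receivedPower p X T c z n ω := by
  filter_upwards [ae_summable_clusterPower hp hnet c,
    ae_activeDevice_nonneg hp hnet.clusters c] with ω h1 h2
  refine h1.of_nonneg_of_le (fun n => receivedPower_nonneg hp (h2 n) z) fun n => ?_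
  rw [← sum_receivedPower hp (h2 n)]
  exact Finset.single_le_sum (f := fun z => receivedPower p X T c z n ω)
    (fun z _ => receivedPower_nonneg hp (h2 n) z) (Finset.mem_univ z)

/-- Exchanging the sum over states with the series needs each series to converge, since a divergent
real `tsum` is 0 by convention. -/
theorem ae_interference_eq [IsProbabilityMeasure P] (hp : p.Admissible)
    (hnet : IsNetwork p P X T) (c : Fin p.M) :
    ∀ᵐ ω ∂P, interference p X T c ω = ∑' n, p.clusterPower c (X n ω) (T n ω) := by
  filter_upwards [ae_all_iff.2 fun z : LinkType => ae_summable_receivedPower hp hnet c z,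
    ae_activeDevice_nonneg hp hnet.clusters c] with ω h1 h2
  unfold interference
  rw [← Summable.tsum_finsetSum fun z _ => h1 z]
  exact tsum_congr fun n => sum_receivedPower hp (h2 n)

theorem integrable_exp_neg_interference [IsProbabilityMeasure P] (hp : p.Admissible)
    (hnet : IsNetwork p P X T) (c : Fin p.M) {s : ℝ} (hs : 0 ≤ s) :
    Integrable (fun ω => Real.exp (-s * interference p X T c ω)) P := by
  refine Integrable.of_bound (C := 1) ?_ ?_
  -- Measurability is inherited from the partial sums of `clusterPower`, which converge almost
  -- surely to the interference.
  · refine aestronglyMeasurable_of_tendsto_ae atTop (f := fun k ω =>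
      Real.exp (-s * ∑ n ∈ Finset.range k, p.clusterPower c (X n ω) (T n ω))) (fun k => ?_) ?_
    · have hm : ∀ n, Measurable fun ω => p.clusterPower c (X n ω) (T n ω) := fun n =>
        (p.measurable_clusterPower c).comp
          ((hnet.parents.measurable n).prodMk (hnet.clusters.measurable n))
      have := Finset.measurable_sum (Finset.range k) fun n _ => hm n
      exact (Real.measurable_exp.comp (this.const_mul (-s))).aestronglyMeasurable
    · filter_upwards [ae_summable_clusterPower hp hnet c, ae_interference_eq hp hnet c]
        with ω h1 h2
      rw [h2]
      exact (Real.continuous_exp.tendsto _).comp (h1.hasSum.tendsto_sum_nat.const_mul _)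
  · filter_upwards [ae_interference_eq hp hnet c] with ω h
    rw [h, Real.norm_eq_abs, abs_of_pos (Real.exp_pos _), Real.exp_le_one_iff, neg_mul,
      neg_nonpos]
    exact mul_nonneg hs (tsum_nonneg fun n => p.clusterPower_nonneg c _ _)

theorem laplaceTransform_interference [IsProbabilityMeasure P] (hp : p.Admissible)
    (hnet : IsNetwork p P X T) (c : Fin p.M) {s : ℝ} (hs : 0 ≤ s) :
    laplaceTransform P (interference p X T c) s =
      Real.exp (-∫ x, (1 - ∫ t, Real.exp (-(s * p.clusterPower c x t)) ∂p.clusterLaw)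
        ∂(ENNReal.ofReal p.lam • (volume : Measure Plane))) := by
  have := hp.isProbabilityMeasure_clusterLaw
  have := p.sigmaFinite_intensity
  rw [← integral_exp_neg_tsum_marked hnet.parents hnet.clusters
    (f := fun x t => s * p.clusterPower c x t) ((p.measurable_clusterPower c).const_mul s)
    (fun x t => mul_nonneg hs (p.clusterPower_nonneg c x t))
    (hp.lintegral_mul_clusterPower_ne_top c hs)]
  refine integral_congr_ae ?_
  filter_upwards [ae_interference_eq hp hnet c] with ω h
  rw [h, tsum_mul_left, neg_mul]

end UavNetwork

theorem lemma2 {Ω : Type*} [MeasurableSpace Ω] (P : Measure Ω) [IsProbabilityMeasure P]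
    (p : UavNetwork.Params) (hp : p.Admissible)
    (X : ℕ → Ω → UavNetwork.Plane) (T : ℕ → Ω → p.ClusterMark)
    (hnet : UavNetwork.IsNetwork p P X T) (c : Fin p.M) (s : ℝ) (hs : 0 ≤ s) :
    (∀ z, ∀ᵐ ω ∂P, Summable fun n => UavNetwork.receivedPower p X T c z n ω) ∧
    Integrable (fun ω => Real.exp (-s * UavNetwork.interference p X T c ω)) P ∧
    (∀ z, IntervalIntegrable (fun q => (1 - p.Oe1 z s q) * q * p.linkProb z q) volume 0 p.R ∧
      IntegrableOn (fun q => (1 - p.Oe2 z s q) * q * p.linkProb z q) (Set.Ioi p.R) volume) ∧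
    UavNetwork.laplaceTransform P (UavNetwork.interference p X T c) s =
      ∏ z : UavNetwork.LinkType, Real.exp (-2 * Real.pi * p.lam *
        ((∫ q in (0 : ℝ)..p.R, (1 - p.Oe1 z s q) * q * p.linkProb z q) +
          ∫ q in Set.Ioi p.R, (1 - p.Oe2 z s q) * q * p.linkProb z q)) := by
  refine ⟨UavNetwork.ae_summable_receivedPower hp hnet c,
    UavNetwork.integrable_exp_neg_interference hp hnet c hs, fun z => ⟨?_, ?_⟩, ?_⟩
  · exact (intervalIntegrable_iff_integrableOn_Ioc_of_le hp.R_pos.le).2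
      (hp.integrableOn_Oe1 c hs z)
  · exact hp.integrableOn_Oe2 c hs z
  · rw [UavNetwork.laplaceTransform_interference hp hnet c hs,
      hp.integral_one_sub_exp_neg_clusterPower c hs, ← Real.exp_sum, ← Finset.sum_neg_distrib]
    congr 1
    refine Finset.sum_congr rfl fun z _ => ?_
    ring
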